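/- **Setting.** Let $\alpha,\eta,\theta,R$ be real $N\times N$ matrices with $\alpha^{T}=\alpha>0$, $\eta^{T}=\eta\ge 0$, $\theta^{T}=-\theta$, $R^{T}=R\ge 0$ and $N_R:=\operatorname{rank}R>0$. On $H=\mathbb{C}^{2N}=\mathbb C^N\oplus\mathbb C^N$ with the standard inner product put $$\Omega=\begin{bmatrix}-2\mathrm{i}K_p\theta K_p^{T}&-\mathrm{i}\Phi^{T}\\ \mathrm{i}\Phi&0\end{bmatrix},\quad B=\begin{bmatrix}K_pRK_p^{T}&0\\0&0\end{bmatrix},\quad K_p=\sqrt{\alpha}^{\,-1},\ \Phi=\sqrt{\eta}\,K_p^{T},\quad A(\beta)=\Omega-\mathrm{i}\beta B .$$ Let $\omega_{\max}$ be the largest eigenvalue of $\Omega$, $b_{\min}$ the smallest nonzero eigenvalue of $B$, and $P_B^{\perp}$ the orthogonal projection onto $\operatorname{Ker}B$. Write $D(z;r)=\{\lambda\in\mathbb C:|\lambda-z|\le r\}$, and $$c(\beta)=\frac{2\omega_{\max}^2}{b_{\min}}\Big(\beta-\frac{2\omega_{\max}}{b_{\min}}\Big)^{-1}\ \Big(\beta>\tfrac{2\omega_{\max}}{b_{\min}}\Big),\qquad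 c^{-1}(y)=\frac{2\omega_{\max}^2}{b_{\min}}\,y^{-1}+\frac{2\omega_{\max}}{b_{\min}}\ (y>0),$$ $$\sigma_0(A(\beta))=\sigma(A(\beta))\cap D(0;\omega_{\max}),\qquad \sigma_1(A(\beta))=\sigma(A(\beta))\cap\bigcup_{0\ne b\in\sigma(B)}D(-\mathrm{i}\beta b;\omega_{\max}).$$ **Theorem (modal dichotomy II).** Assume $N_R<N$ and $P_B^{\perp}\Omega P_B^{\perp}\neq 0$, let $\rho_{\min}$ be the smallest positive eigenvalue of $P_B^{\perp}\Omega P_B^{\perp}$, and let $\beta>c^{-1}(\rho_{\min}/2)$. Then $\beta>2\omega_{\max}/b_{\min}$, $c(\beta)<\rho_{\min}/2\le\omega_{\max}/2$, and the following hold. 1. $\sigma(A(\beta))$ is the disjoint union of $\sigma_0(A(\beta))$ and $\sigma_1(A(\beta))$, and there are unique $A(\beta)$-invariant subspaces $H_{h\ell},H_{\ell\ell}$ with $H=H_{h\ell}\oplus H_{\ell\ell}$, $\sigma(A(\beta)|_{H_{\ell\ell}})=\sigma_0(A(\beta))$ and $\sigma(A(\beta)|_{H_{h\ell}})=\sigma_1(A(\beta))$.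 Moreover $\dim H_{h\ell}=N_R$ and $\dim H_{\ell\ell}=2N-N_R$. 2. $\sigma(A(\beta)|_{H_{\ell\ell}})=\{\zeta\in\sigma(A(\beta)):0\le-\operatorname{Im}\zeta\le\omega_{\max}\}$ and $\sigma(A(\beta)|_{H_{h\ell}})=\{\zeta\in\sigma(A(\beta)):-\operatorname{Im}\zeta\ge\beta b_{\min}-\omega_{\max}\}$, where $\beta b_{\min}-\omega_{\max}>\omega_{\max}$; and for $\zeta\in\sigma(A(\beta)|_{H_{h\ell}})$, $$\frac12\frac{|\operatorname{Re}\zeta|}{-\operatorname{Im}\zeta}\le\frac12\frac{\omega_{\max}}{\beta b_{\min}-\omega_{\max}}<\frac12 .$$ 3. For every $\zeta\in\sigma(A(\beta)|_{H_{\ell\ell}})$: $\min_{\rho\in\sigma(P_B^\perp\Omega P_B^\perp)}|\zeta-\rho|\le c(\beta)$, $\min_{\rho\in\sigma(P_B^\perp\Omega P_B^\perp)}|\operatorname{Re}\zeta-\rho|\le c(\beta)$ and $0\le-\operatorname{Im}\zeta\le c(\beta)$. 4. There are unique $A(\beta)$-invariant subspaces $H_{\ell\ell,0},H_{\ell\ell,1}$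 with $H_{\ell\ell}=H_{\ell\ell,0}\oplus H_{\ell\ell,1}$, $$\sigma(A(\beta)|_{H_{\ell\ell,0}})=\sigma(A(\beta))\cap D(0;c(\beta)),\qquad \sigma(A(\beta)|_{H_{\ell\ell,1}})=\sigma(A(\beta))\cap\bigcup_{0\ne\rho\in\sigma(P_B^{\perp}\Omega P_B^{\perp})}D(\rho;c(\beta)).$$ Furthermore $\sigma(A(\beta)|_{H_{\ell\ell,1}})=\sigma(A(\beta))\cap\{\rho_{\min}/2<|\zeta|\le\omega_{\max}\}$ and $\sigma(A(\beta)|_{H_{\ell\ell,0}})=\sigma(A(\beta))\cap\{|\zeta|<\rho_{\min}/2\}$. 5. $\dim H_{\ell\ell,1}=\operatorname{rank}(P_B^{\perp}\Omega P_B^{\perp})$ and $\dim H_{\ell\ell,0}=2N-N_R-\dim H_{\ell\ell,1}$. If $\operatorname{Ker}R\cap\operatorname{Ker}\eta=\{0\}$, then $\dim H_{\ell\ell,1}=2(N-N_R)$. -/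

import Mathlib

noncomputable section

/-- The Hilbert space `ℂ^N ⊕ ℂ^N = ℂ^(2N)` with its standard inner product. -/
abbrev PhaseSpace (N : ℕ) : Type := EuclideanSpace ℂ (Fin N ⊕ Fin N)

open scoped MatrixOrder Matrix.Norms.L2Operator in
/-- The positive semidefinite square root of a real positive semidefinite matrix. -/
def psdSqrt {N : ℕ} (M : Matrix (Fin N) (Fin N) ℝ) : Matrix (Fin N) (Fin N) ℝ :=
  CFC.sqrt M

/-- The data of the Lagrangian system `α Q'' + (2 θ + β R) Q' + η Q = 0`: real `N × N` matrices with
`α` symmetric positive definite, `η` and `R` symmetric positive semidefinite, `θ` skew-symmetric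
and `R ≠ 0`. -/
structure LagrangianSystem (N : ℕ) where
  α : Matrix (Fin N) (Fin N) ℝ
  η : Matrix (Fin N) (Fin N) ℝ
  θ : Matrix (Fin N) (Fin N) ℝ
  R : Matrix (Fin N) (Fin N) ℝ
  α_posDef : α.PosDef
  η_posSemidef : η.PosSemidef
  θ_skew : θ.transpose = -θ
  R_posSemidef : R.PosSemidef
  rank_R_pos : 0 < R.rank

namespace LagrangianSystem

variable {N : ℕ} (S : LagrangianSystem N)

/-- `K_p = (√α)⁻¹`. -/
def Kp : Matrix (Fin N) (Fin N) ℝ := (psdSqrt S.α)⁻¹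

/-- `K_q = √η`. -/
def Kq : Matrix (Fin N) (Fin N) ℝ := psdSqrt S.η

/-- `Φ = K_q K_pᵀ`. -/
def Phi : Matrix (Fin N) (Fin N) ℝ := S.Kq * S.Kp.transpose

/-- The matrix `[[-2i K_p θ K_pᵀ, -i Φᵀ], [i Φ, 0]]`. -/
def OmegaMatrix : Matrix (Fin N ⊕ Fin N) (Fin N ⊕ Fin N) ℂ :=
  Matrix.fromBlocks
    ((-(2 * Complex.I)) • (S.Kp * S.θ * S.Kp.transpose).map Complex.ofReal)
    ((-Complex.I) • S.Phi.transpose.map Complex.ofReal)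
    (Complex.I • S.Phi.map Complex.ofReal)
    0

/-- The matrix `[[K_p R K_pᵀ, 0], [0, 0]]`. -/
def BMatrix : Matrix (Fin N ⊕ Fin N) (Fin N ⊕ Fin N) ℂ :=
  Matrix.fromBlocks ((S.Kp * S.R * S.Kp.transpose).map Complex.ofReal) 0 0 0

/-- The frequency operator `Ω` on `ℂ^(2N)`. -/
def Omega : Module.End ℂ (PhaseSpace N) := Matrix.toEuclideanLin S.OmegaMatrix

/-- The dissipation operator `B` on `ℂ^(2N)`. -/
def B : Module.End ℂ (PhaseSpace N) := Matrix.toEuclideanLin S.BMatrix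

/-- The system operator `A(β) = Ω - i β B`. -/
def A (β : ℝ) : Module.End ℂ (PhaseSpace N) := S.Omega - (Complex.I * (β : ℂ)) • S.B

/-- `P_B^⊥`: the orthogonal projection of `ℂ^(2N)` onto `Ker B`. -/
def projKerB : Module.End ℂ (PhaseSpace N) := ((LinearMap.ker S.B).starProjection).toLinearMap

/-- The compressed operator `P_B^⊥ Ω P_B^⊥` on `ℂ^(2N)`. -/
def compressedOmega : Module.End ℂ (PhaseSpace N) := S.projKerB * S.Omega * S.projKerB

/-- The largest eigenvalue of `Ω` (all eigenvalues of the Hermitian operator `Ω` are real). -/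
def omegaMax : ℝ := sSup {x : ℝ | (x : ℂ) ∈ spectrum ℂ S.Omega}

/-- The smallest nonzero eigenvalue of `B` (all eigenvalues of `B ≥ 0` are real and nonnegative,
and `B ≠ 0`). -/
def bMin : ℝ := sInf {x : ℝ | x ≠ 0 ∧ (x : ℂ) ∈ spectrum ℂ S.B}

/-- The smallest positive eigenvalue of `P_B^⊥ Ω P_B^⊥`; meaningful when this operator is nonzero. -/
def rhoMin : ℝ := sInf {x : ℝ | 0 < x ∧ (x : ℂ) ∈ spectrum ℂ S.compressedOmega}

/-- `c(β) = (2 ω_max² / b_min) (β - 2 ω_max / b_min)⁻¹`, for `β > 2 ω_max / b_min`. -/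
def c (β : ℝ) : ℝ :=
  (2 * S.omegaMax ^ 2 / S.bMin) * (β - 2 * S.omegaMax / S.bMin)⁻¹

/-- The inverse function `c⁻¹(y) = (2 ω_max² / b_min) y⁻¹ + 2 ω_max / b_min`, for `y > 0`. -/
def cInv (y : ℝ) : ℝ :=
  (2 * S.omegaMax ^ 2 / S.bMin) * y⁻¹ + 2 * S.omegaMax / S.bMin

/-- `σ₀(A(β))`: the eigenvalues of `A(β)` in the closed disc of radius `ω_max` about `0`. -/
def spectrumZero (β : ℝ) : Set ℂ :=
  spectrum ℂ (S.A β) ∩ Metric.closedBall 0 S.omegaMax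

/-- `σ₁(A(β))`: the eigenvalues of `A(β)` in the closed discs of radius `ω_max` about the points
`-i β b`, where `b` runs through the nonzero eigenvalues of `B`. -/
def spectrumOne (β : ℝ) : Set ℂ :=
  spectrum ℂ (S.A β) ∩
    ⋃ b ∈ spectrum ℂ S.B \ {0}, Metric.closedBall (-(Complex.I * (β : ℂ) * b)) S.omegaMax

/-- The union of the closed discs `D(ρ; r)` over the nonzero eigenvalues `ρ` of
`P_B^⊥ Ω P_B^⊥`. -/
def rhoDiscs (r : ℝ) : Set ℂ :=
  ⋃ ρ ∈ spectrum ℂ S.compressedOmega \ {0}, Metric.closedBall ρ r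

end LagrangianSystem

/-- `W` is an invariant subspace of `T` and the spectrum of the restriction `T|_W` is the set `s`. -/
def HasRestrictedSpectrum {N : ℕ} (T : Module.End ℂ (PhaseSpace N))
    (W : Submodule ℂ (PhaseSpace N)) (s : Set ℂ) : Prop :=
  ∃ hW : ∀ x ∈ W, T x ∈ W, spectrum ℂ (T.restrict hW) = s

namespace LagrangianSystem

variable {N : ℕ} (S : LagrangianSystem N)

/-- The pair of high-loss and low-loss subspaces: `H = H_hℓ ⊕ H_ℓℓ` with both subspaces
invariant under `A(β)`, `σ(A(β)|H_ℓℓ) = σ₀(A(β))` and `σ(A(β)|H_hℓ) = σ₁(A(β))`. -/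
structure IsLossSplitting (β : ℝ) (Hhl Hll : Submodule ℂ (PhaseSpace N)) : Prop where
  isCompl : IsCompl Hhl Hll
  spectrum_low : HasRestrictedSpectrum (S.A β) Hll (S.spectrumZero β)
  spectrum_high : HasRestrictedSpectrum (S.A β) Hhl (S.spectrumOne β)

/-- The splitting of a low-loss subspace: `H_ℓℓ = H_ℓℓ,0 ⊕ H_ℓℓ,1` with both summands invariant
under `A(β)`, `σ(A(β)|H_ℓℓ,0) = σ(A(β)) ∩ D(0; c(β))` and `σ(A(β)|H_ℓℓ,1)` the part of `σ(A(β))`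
in the union of the discs `D(ρ; c(β))` over the nonzero eigenvalues `ρ` of `P_B^⊥ Ω P_B^⊥`. -/
structure IsLowLossSplitting (β : ℝ) (Hll H0 H1 : Submodule ℂ (PhaseSpace N)) : Prop where
  sup_eq : H0 ⊔ H1 = Hll
  disjoint : Disjoint H0 H1
  spectrum_zero : HasRestrictedSpectrum (S.A β) H0
    (spectrum ℂ (S.A β) ∩ Metric.closedBall 0 (S.c β))
  spectrum_one : HasRestrictedSpectrum (S.A β) H1
    (spectrum ℂ (S.A β) ∩ S.rhoDiscs (S.c β))

end LagrangianSystem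

end

/-! Write `A` for `A(β)`, `K` for the kernel of `B`, `P` for the orthogonal projection onto `K`, `C
= P Ω P`, `ω = omegaMax` and `b = bMin`.

Coarse localization: if `A v = ζ v`, then `ζ v + iβ B v = Ω v` has norm at most `ω ‖v‖`, so `ζ` lies
within `ω` of an eigenvalue of `-iβ B`. Since `β b > 2 ω`, the disc about `0` is separated from the
others. The subspaces of the theorem are sums of generalized eigenspaces, and their uniqueness
follows from the modular law.

Dimensions are found by Lyapunov's inertia argument (`re_inner_pos_of_lyapunov`), without contour
integrals or deformation in `β`. With `s = 2ω/(βb) < 1`, the form `‖x₁‖² - s²‖x₂‖²` on `Kᗮ ⊕ K`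
satisfies the Lyapunov inequality for `iA - βb/2`. Hence it is positive definite on the high-loss
subspace and negative definite on the low-loss one. These subspaces therefore project injectively to
`Kᗮ` and `K`, and since the dimensions add up, both maps are bijective.

The same argument gives the cone bound `‖x₁‖ < s ‖x₂‖` for every nonzero low-loss `x`. As `P A x - C
P x = P Ω x₁`, the projection `P` intertwines `A` with `C` on the low-loss subspace up to a relative
error below `ω s ≤ c(β)`. Applied to eigenvectors, this puts each low-loss eigenvalue within `c(β)`
of the spectrum of `C`. Since `c(β) < rhoMin / 2`, a second inertia argument
(`finrank_eq_finrank_spectralSubspace_pos`), used for `A` and for `-A`, matches the numbers of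
low-loss eigenvalues to the right and to the left with those of positive and negative eigenvalues of
`C`; together they give the rank of `C`.

Finally, `Ω` vanishes as a form on `0 ⊕ ℂ^N`, a subspace of `K`; if the kernels of `R` and `η` meet
trivially, the off-diagonal block of the compression is injective, which determines its rank. -/

open Module

/-! ### Sums of generalized eigenspaces and invariant subspaces -/

section SpectralSubspace

variable {E : Type*} [AddCommGroup E] [Module ℂ E]

/-- The sum of the generalized eigenspaces of `T` for the eigenvalues in `s`. -/
def spectralSubspace (T : End ℂ E) (s : Set ℂ) : Submodule ℂ E :=
  ⨆ ζ ∈ s, T.maxGenEigenspace ζ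

theorem spectralSubspace_mono (T : End ℂ E) {s t : Set ℂ} (h : s ⊆ t) :
    spectralSubspace T s ≤ spectralSubspace T t :=
  biSup_mono h

theorem spectralSubspace_union (T : End ℂ E) (s t : Set ℂ) :
    spectralSubspace T (s ∪ t) = spectralSubspace T s ⊔ spectralSubspace T t :=
  iSup_union

theorem apply_mem_spectralSubspace (T : End ℂ E) (s : Set ℂ) :
    ∀ x ∈ spectralSubspace T s, T x ∈ spectralSubspace T s := by
  intro x hx
  have : spectralSubspace T s ≤ (spectralSubspace T s).comap T := by
    refine iSup₂_le fun ζ hζ y hy ↦ ?_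
    exact (le_biSup (fun ζ ↦ T.maxGenEigenspace ζ) hζ)
      (End.mapsTo_maxGenEigenspace_of_comm (Commute.refl T) ζ hy)
  exact this hx

theorem disjoint_spectralSubspace (T : End ℂ E) {s t : Set ℂ} (h : Disjoint s t) :
    Disjoint (spectralSubspace T s) (spectralSubspace T t) :=
  T.independent_maxGenEigenspace.disjoint_biSup_biSup h

theorem mem_spectralSubspace_of_eigenvector {T : End ℂ E} {s : Set ℂ} {ζ : ℂ} (hζ : ζ ∈ s) {v : E}
    (hv : T v = ζ • v) : v ∈ spectralSubspace T s :=
  (le_biSup (fun ζ ↦ T.maxGenEigenspace ζ) hζ)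
    (End.eigenspace_le_maxGenEigenspace (End.mem_eigenspace_iff.2 hv))

theorem mem_of_eigenvector_mem_spectralSubspace {T : End ℂ E} {s : Set ℂ} {ζ : ℂ} {v : E}
    (hvs : v ∈ spectralSubspace T s) (hv0 : v ≠ 0) (hv : T v = ζ • v) : ζ ∈ s := by
  by_contra h
  have h1 := disjoint_spectralSubspace T (Set.disjoint_singleton_right.2 h)
  exact hv0 (Submodule.disjoint_def.1 h1 v hvs (mem_spectralSubspace_of_eigenvector (Set.mem_singleton ζ) hv))

variable [FiniteDimensional ℂ E]

theorem mem_spectrum_iff_exists_eigenvector {T : End ℂ E} {ζ : ℂ} :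
    ζ ∈ spectrum ℂ T ↔ ∃ v, v ≠ 0 ∧ T v = ζ • v := by
  rw [← End.hasEigenvalue_iff_mem_spectrum]
  constructor
  · intro h
    obtain ⟨v, hv⟩ := h.exists_hasEigenvector
    exact ⟨v, hv.2, hv.apply_eq_smul⟩
  · rintro ⟨v, hv0, hv⟩
    exact End.hasEigenvalue_of_hasEigenvector ⟨End.mem_eigenspace_iff.2 hv, hv0⟩

theorem mem_spectrum_restrict_iff {T : End ℂ E} {W : Submodule ℂ E} (hW : ∀ x ∈ W, T x ∈ W)
    {ζ : ℂ} : ζ ∈ spectrum ℂ (T.restrict hW) ↔ ∃ v ∈ W, v ≠ 0 ∧ T v = ζ • v := by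
  rw [mem_spectrum_iff_exists_eigenvector]
  constructor
  · rintro ⟨v, hv0, hv⟩
    exact ⟨v, v.2, by simpa using hv0, by simpa using congrArg Subtype.val hv⟩
  · rintro ⟨v, hvW, hv0, hv⟩
    exact ⟨⟨v, hvW⟩, by simpa using hv0, Subtype.ext hv⟩

theorem spectralSubspace_univ (T : End ℂ E) : spectralSubspace T Set.univ = ⊤ := by
  simpa [spectralSubspace] using T.iSup_maxGenEigenspace_eq_top

theorem finrank_spectralSubspace_union (T : End ℂ E) {s t : Set ℂ} (h : Disjoint s t) :
    finrank ℂ (spectralSubspace T (s ∪ t)) =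
      finrank ℂ (spectralSubspace T s) + finrank ℂ (spectralSubspace T t) := by
  have := Submodule.finrank_sup_add_finrank_inf_eq (spectralSubspace T s) (spectralSubspace T t)
  rw [(disjoint_spectralSubspace T h).eq_bot, ← spectralSubspace_union] at this
  simpa using this

/-- An invariant subspace is the sum of its intersections with the generalized eigenspaces of `T`;
such an intersection is zero unless the restriction of `T` has the corresponding eigenvalue. This is
the source of all uniqueness statements. -/
theorem le_spectralSubspace {T : End ℂ E} {W : Submodule ℂ E} (hW : ∀ x ∈ W, T x ∈ W) {s : Set ℂ}
    (h : ∀ ζ, ∀ v ∈ W, v ≠ 0 → T v = ζ • v → ζ ∈ s) : W ≤ spectralSubspace T s := by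
  have h1 := Submodule.eq_iSup_inf_genEigenspace (p := W) (f := T) ⊤ hW
    T.iSup_maxGenEigenspace_eq_top
  rw [h1]
  refine iSup_le fun ζ ↦ ?_
  by_cases hζ : ζ ∈ s
  · exact inf_le_right.trans (le_biSup (fun ζ ↦ T.maxGenEigenspace ζ) hζ)
  · suffices W ⊓ T.genEigenspace ζ ⊤ = ⊥ by rw [this]; exact bot_le
    rw [Submodule.inf_genEigenspace T W hW]
    by_contra hne
    have h2 : End.HasUnifEigenvalue (T.restrict hW) ζ ⊤ := fun h3 ↦ hne (by rw [h3, Submodule.map_bot])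
    have h3 := (End.hasUnifEigenvalue_iff_hasUnifEigenvalue_one (by simp)).1 h2
    obtain ⟨v, hvW, hv0, hv⟩ := (mem_spectrum_restrict_iff hW).1 h3.mem_spectrum
    exact hζ (h ζ v hvW hv0 hv)

/-- Points outside the spectrum contribute only the zero subspace. -/
theorem spectralSubspace_congr (T : End ℂ E) {s t : Set ℂ}
    (h : spectrum ℂ T ∩ s ⊆ t) : spectralSubspace T s ≤ spectralSubspace T t :=
  le_spectralSubspace (apply_mem_spectralSubspace T s) fun _ v hv hv0 hTv ↦
    h ⟨mem_spectrum_iff_exists_eigenvector.2 ⟨v, hv0, hTv⟩,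
      mem_of_eigenvector_mem_spectralSubspace hv hv0 hTv⟩

end SpectralSubspace

section Restricted

variable {N : ℕ} {T : End ℂ (PhaseSpace N)}

theorem hasRestrictedSpectrum_spectralSubspace {s : Set ℂ} (hs : s ⊆ spectrum ℂ T) :
    HasRestrictedSpectrum T (spectralSubspace T s) s := by
  refine ⟨apply_mem_spectralSubspace T s, ?_⟩
  ext ζ
  rw [mem_spectrum_restrict_iff]
  constructor
  · rintro ⟨v, hv, hv0, hTv⟩
    exact mem_of_eigenvector_mem_spectralSubspace hv hv0 hTv
  · intro hζ
    obtain ⟨v, hv0, hTv⟩ := mem_spectrum_iff_exists_eigenvector.1 (hs hζ)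
    exact ⟨v, mem_spectralSubspace_of_eigenvector hζ hTv, hv0, hTv⟩

theorem HasRestrictedSpectrum.le_spectralSubspace {W : Submodule ℂ (PhaseSpace N)} {s : Set ℂ}
    (h : HasRestrictedSpectrum T W s) : W ≤ spectralSubspace T s := by
  obtain ⟨hW, rfl⟩ := h
  exact _root_.le_spectralSubspace hW fun ζ v hv hv0 hTv ↦
    (mem_spectrum_restrict_iff hW).2 ⟨v, hv, hv0, hTv⟩

end Restricted

/-- Two pairs of elements of a modular lattice with the same join, one below the other, agree if the
larger pair is disjoint. -/
theorem eq_and_eq_of_le_of_le_of_sup_eq {α : Type*} [Lattice α] [OrderBot α] [IsModularLattice α]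
    {a b c d : α} (hac : a ≤ c) (hbd : b ≤ d) (hcd : Disjoint c d) (h : c ⊔ d ≤ a ⊔ b) :
    a = c ∧ b = d := by
  have key : ∀ {a b c d : α}, a ≤ c → b ≤ d → Disjoint c d → c ⊔ d ≤ a ⊔ b → c ≤ a := by
    intro a b c d hac hbd hcd h
    -- The modular law absorbs `b ⊓ c`, which vanishes because `b ≤ d` and `c`, `d` are disjoint.
    calc c ≤ (a ⊔ b) ⊓ c := le_inf (le_sup_left.trans h) le_rfl
      _ = a ⊔ b ⊓ c := (sup_inf_assoc_of_le b hac)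
      _ ≤ a := sup_le le_rfl ((inf_comm b c ▸ (hcd.mono_right hbd).eq_bot).le.trans bot_le)
  exact ⟨hac.antisymm (key hac hbd hcd h),
    hbd.antisymm (key hbd hac hcd.symm (by rwa [sup_comm d, sup_comm b]))⟩

/-! ### Eigenvalue estimates for symmetric operators -/

section Symmetric

variable {E : Type*} [NormedAddCommGroup E] [InnerProductSpace ℂ E] [FiniteDimensional ℂ E]
  {T : End ℂ E}

theorem LinearMap.IsSymmetric.ofReal_eigenvalues_mem_spectrum (hT : T.IsSymmetric)
    (i : Fin (finrank ℂ E)) : ((hT.eigenvalues rfl i : ℝ) : ℂ) ∈ spectrum ℂ T :=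
  (hT.hasEigenvalue_eigenvalues rfl i).mem_spectrum

/-- Parseval in an orthonormal eigenbasis. The complex factor `a` covers the normal operators `iβ B
+ ζ`, which are not symmetric. -/
theorem LinearMap.IsSymmetric.norm_sq_smul_add_smul (hT : T.IsSymmetric) (a z : ℂ) (x : E) :
    ‖a • T x + z • x‖ ^ 2 = ∑ i, ‖a * (hT.eigenvalues rfl i : ℝ) + z‖ ^ 2 *
      ‖(hT.eigenvectorBasis rfl).repr x i‖ ^ 2 := by
  rw [← (hT.eigenvectorBasis rfl).repr.norm_map, EuclideanSpace.norm_sq_eq]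
  refine Finset.sum_congr rfl fun i _ ↦ ?_
  rw [← mul_pow, ← norm_mul, map_add, map_smul, map_smul]
  simp only [PiLp.add_apply, PiLp.smul_apply, smul_eq_mul]
  rw [hT.eigenvectorBasis_apply_self_apply rfl x i]
  congr 2
  simp only [RCLike.ofReal_eq_complex_ofReal]
  ring

/-- If `x` is an approximate eigenvector of a symmetric operator, there is an eigenvalue nearby. -/
theorem LinearMap.IsSymmetric.exists_mem_spectrum_norm_le (hT : T.IsSymmetric) {a z : ℂ} {m : ℝ}
    {x : E} (hx : x ≠ 0) (h : ‖a • T x + z • x‖ ≤ m * ‖x‖) :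
    ∃ μ : ℝ, (μ : ℂ) ∈ spectrum ℂ T ∧ ‖a * μ + z‖ ≤ m := by
  by_contra! hcon
  have hm : 0 ≤ m := nonneg_of_mul_nonneg_left ((norm_nonneg _).trans h) (norm_pos_iff.2 hx)
  have h1 : ‖x‖ ^ 2 = ∑ i, ‖(hT.eigenvectorBasis rfl).repr x i‖ ^ 2 := by
    rw [← (hT.eigenvectorBasis rfl).repr.norm_map, EuclideanSpace.norm_sq_eq]
  have h2 : (m * ‖x‖) ^ 2 < ‖a • T x + z • x‖ ^ 2 := by
    rw [hT.norm_sq_smul_add_smul, mul_pow, h1, Finset.mul_sum]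
    have hlt : ∀ i, m ^ 2 < ‖a * (hT.eigenvalues rfl i : ℝ) + z‖ ^ 2 := fun i ↦
      pow_lt_pow_left₀ (hcon _ (hT.ofReal_eigenvalues_mem_spectrum i)) hm two_ne_zero
    obtain ⟨i, hi⟩ : ∃ i, (hT.eigenvectorBasis rfl).repr x i ≠ 0 := by
      by_contra! h0
      exact hx ((hT.eigenvectorBasis rfl).repr.map_eq_zero_iff.1 (PiLp.ext h0))
    refine Finset.sum_lt_sum (fun j _ ↦ mul_le_mul_of_nonneg_right (hlt j).le (sq_nonneg _)) ⟨i, Finset.mem_univ _, ?_⟩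
    exact mul_lt_mul_of_pos_right (hlt i) (pow_pos (norm_pos_iff.2 hi) 2)
  exact absurd (pow_le_pow_left₀ (norm_nonneg _) h 2) (not_le.2 h2)

theorem LinearMap.IsSymmetric.norm_apply_le (hT : T.IsSymmetric) {M : ℝ} (hM : 0 ≤ M)
    (h : ∀ μ : ℝ, (μ : ℂ) ∈ spectrum ℂ T → |μ| ≤ M) (x : E) : ‖T x‖ ≤ M * ‖x‖ := by
  have h1 : ‖x‖ ^ 2 = ∑ i, ‖(hT.eigenvectorBasis rfl).repr x i‖ ^ 2 := by
    rw [← (hT.eigenvectorBasis rfl).repr.norm_map, EuclideanSpace.norm_sq_eq]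
  refine le_of_sq_le_sq ?_ (by positivity)
  have h2 := hT.norm_sq_smul_add_smul 1 0 x
  rw [one_smul, zero_smul, add_zero] at h2
  rw [h2, mul_pow, h1, Finset.mul_sum]
  refine Finset.sum_le_sum fun i _ ↦ ?_
  gcongr
  simpa using h _ (hT.ofReal_eigenvalues_mem_spectrum i)

/-- A lower bound for the quadratic form of a symmetric operator at a vector, by the eigenvalues
having an eigenvector not orthogonal to that vector. -/
theorem LinearMap.IsSymmetric.mul_norm_sq_le_re_inner (hT : T.IsSymmetric) {m : ℝ} {x : E}
    (h : ∀ (μ : ℝ) (v : E), T v = (μ : ℂ) • v → inner ℂ v x ≠ 0 → m ≤ μ) :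
    m * ‖x‖ ^ 2 ≤ (inner ℂ x (T x)).re := by
  have h1 : ‖x‖ ^ 2 = ∑ i, ‖(hT.eigenvectorBasis rfl).repr x i‖ ^ 2 := by
    rw [← (hT.eigenvectorBasis rfl).repr.norm_map, EuclideanSpace.norm_sq_eq]
  have h2 : (inner ℂ x (T x)).re = ∑ i, hT.eigenvalues rfl i *
      ‖(hT.eigenvectorBasis rfl).repr x i‖ ^ 2 := by
    rw [← (hT.eigenvectorBasis rfl).repr.inner_map_map, PiLp.inner_apply, Complex.re_sum]
    refine Finset.sum_congr rfl fun i _ ↦ ?_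
    rw [hT.eigenvectorBasis_apply_self_apply rfl x i]
    simp only [RCLike.ofReal_eq_complex_ofReal, RCLike.inner_apply, mul_assoc, Complex.mul_conj,
      Complex.re_ofReal_mul, Complex.ofReal_re, Complex.normSq_eq_norm_sq]
  rw [h2, h1, Finset.mul_sum]
  refine Finset.sum_le_sum fun i _ ↦ ?_
  by_cases hi : (hT.eigenvectorBasis rfl).repr x i = 0
  · simp [hi]
  · gcongr
    refine h _ _ (hT.apply_eigenvectorBasis rfl i) ?_
    rwa [← OrthonormalBasis.repr_apply_apply]

theorem LinearMap.IsSymmetric.im_eq_zero_of_mem_spectrum (hT : T.IsSymmetric) {ζ : ℂ}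
    (hζ : ζ ∈ spectrum ℂ T) : ζ.im = 0 :=
  Complex.conj_eq_iff_im.1 (hT.conj_eigenvalue_eq_self (End.hasEigenvalue_iff_mem_spectrum.2 hζ))

theorem LinearMap.IsSymmetric.ofReal_re_of_mem_spectrum (hT : T.IsSymmetric) {ζ : ℂ}
    (hζ : ζ ∈ spectrum ℂ T) : ((ζ.re : ℝ) : ℂ) = ζ :=
  Complex.ext rfl (hT.im_eq_zero_of_mem_spectrum hζ).symm

end Symmetric

/-! ### Lyapunov's inertia argument -/

section Lyapunov

variable {E : Type*} [NormedAddCommGroup E] [InnerProductSpace ℂ E] [FiniteDimensional ℂ E]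

/-- **Lyapunov's inertia argument.** Let `⟪J x, y⟫` be a Hermitian form with `re ⟪J x, T x⟫ > 0` on
a `T`-invariant subspace `W`. If all eigenvalues of `T` on `W` have positive real part, then the form
is positive definite on `W`. -/
theorem re_inner_pos_of_lyapunov {J : End ℂ E} (hJ : J.IsSymmetric) (T : End ℂ E)
    (W : Submodule ℂ E) (hW : ∀ x ∈ W, T x ∈ W)
    (hpos : ∀ x ∈ W, x ≠ 0 → 0 < (inner ℂ (J x) (T x)).re)
    (hspec : ∀ ζ : ℂ, ∀ v ∈ W, v ≠ 0 → T v = ζ • v → 0 < ζ.re) :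
    ∀ x ∈ W, x ≠ 0 → 0 < (inner ℂ (J x) x).re := by
  induction hn : finrank ℂ W using Nat.strong_induction_on generalizing T W with
  | _ n ih =>
  intro x hxW hx0
  have hreal : ∀ y, (inner ℂ (J y) y).im = 0 := fun y ↦ hJ.im_inner_apply_self y
  have hnt : Nontrivial W := ⟨⟨⟨x, hxW⟩, 0, by simpa using hx0⟩⟩
  obtain ⟨μ, hμ⟩ := End.exists_eigenvalue (T.restrict hW)
  obtain ⟨u, huW, hu0, hTu⟩ := (mem_spectrum_restrict_iff hW).1 hμ.mem_spectrum
  have hμ0 := hspec μ u huW hu0 hTu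
  have hu : 0 < (inner ℂ (J u) u).re := by
    -- At an eigenvector the hypothesis reads `re μ * ⟪J u, u⟫ > 0`, since `⟪J u, u⟫` is real. This
    -- fixes the sign of the form on the line of `u`.
    have h1 := hpos u huW hu0
    rw [hTu, inner_smul_right, Complex.mul_re, hreal, mul_zero, sub_zero] at h1
    exact pos_of_mul_pos_right h1 hμ0.le
  set g : ℂ := inner ℂ (J u) u with hg
  have hg0 : g ≠ 0 := fun h ↦ by simp [h] at hu
  let φ : E →ₗ[ℂ] ℂ := (innerSL ℂ (J u)).toLinearMap
  have hφ : ∀ y, φ y = inner ℂ (J u) y := fun y ↦ rfl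
  -- Induction on dimension: `T` is compressed to the `J`-orthogonal complement `W'` of `u` in `W`.
  -- The correction is a multiple of `u`, which `⟪J y, ·⟫` does not see for `y ∈ W'`, so the
  -- positivity hypothesis survives.
  let T' : End ℂ E := T - (φ ∘ₗ T).smulRight (g⁻¹ • u)
  have hT' : ∀ y, T' y = T y - (inner ℂ (J u) (T y) * g⁻¹) • u := fun y ↦ by
    simp [T', hφ, smul_smul]
  let W' : Submodule ℂ E := W ⊓ LinearMap.ker φ
  have hW'0 : ∀ y ∈ W', inner ℂ (J u) y = 0 := fun y hy ↦ hy.2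
  have hlt : finrank ℂ W' < n := by
    rw [← hn]
    refine Submodule.finrank_lt_finrank_of_lt (lt_of_le_of_ne inf_le_left fun h ↦ hg0 ?_)
    exact hW'0 u (h ▸ huW)
  have key := ih _ hlt T' W' ?_ ?_ ?_ rfl
  · set a := inner ℂ (J u) x * g⁻¹ with ha
    have hy : x - a • u ∈ W' := by
      refine ⟨W.sub_mem hxW (W.smul_mem _ huW), ?_⟩
      change φ _ = 0
      rw [hφ, inner_sub_right, inner_smul_right, ← hg, ha,
        inv_mul_cancel_right₀ hg0, sub_self]
    set y := x - a • u with hy'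
    have hx : x = y + a • u := by rw [hy']; abel
    have h0 := hW'0 y hy
    have h0' : inner ℂ (J y) u = 0 := by rw [hJ y u, ← inner_conj_symm, h0, map_zero]
    have hexp : (inner ℂ (J x) x).re = (inner ℂ (J y) y).re + ‖a‖ ^ 2 * g.re := by
      rw [hx, map_add, map_smul, inner_add_left, inner_add_right, inner_add_right, inner_smul_right,
        inner_smul_left, inner_smul_left, inner_smul_right, h0, h0', ← hg, mul_zero, mul_zero,
        add_zero, zero_add, ← mul_assoc, ← Complex.normSq_eq_conj_mul_self, Complex.add_re,
        Complex.re_ofReal_mul, Complex.normSq_eq_norm_sq]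
    rw [hexp]
    by_cases hy0 : y = 0
    · have ha0 : a ≠ 0 := by
        rintro h
        rw [hy0, h] at hx
        simp at hx
        exact hx0 hx
      have := norm_pos_iff.2 ha0
      rw [hy0]
      simp only [map_zero, inner_zero_left, Complex.zero_re, zero_add]
      positivity
    · have := key y hy hy0
      positivity
  · intro y hy
    refine ⟨?_, ?_⟩
    · rw [hT']
      exact W.sub_mem (hW y hy.1) (W.smul_mem _ huW)
    · change φ _ = 0
      rw [hφ, hT', inner_sub_right, inner_smul_right, ← hg,
        inv_mul_cancel_right₀ hg0, sub_self]
  · intro y hy hy0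
    have h0 : inner ℂ (J y) u = 0 := by
      rw [hJ y u, ← inner_conj_symm, hW'0 y hy, map_zero]
    rw [hT', inner_sub_right, inner_smul_right, h0, mul_zero, sub_zero]
    exact hpos y hy.1 hy0
  · intro ζ v hv hv0 hTv
    by_cases hζ : ζ = μ
    · rwa [hζ]
    set α := inner ℂ (J u) (T v) * g⁻¹ with hα
    have hTv' : T v = ζ • v + α • u := by rw [← hTv, hT']; abel
    have hζ' : ζ - μ ≠ 0 := sub_ne_zero.2 hζ
    -- An eigenvector of `T'` lifts to one of `T`: from `T v = ζ v + α u` and `T u = μ u`, the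
    -- multiple `x` of `u` to be added must satisfy `α + x μ = ζ x`.
    refine hspec ζ (v + (α * (ζ - μ)⁻¹) • u) (W.add_mem hv.1 (W.smul_mem _ huW)) ?_ ?_
    · intro h
      have h1 : inner ℂ (J u) (v + (α * (ζ - μ)⁻¹) • u) = 0 := by rw [h, inner_zero_right]
      rw [inner_add_right, hW'0 v hv, zero_add, inner_smul_right, ← hg] at h1
      have h2 := (mul_eq_zero.1 h1).resolve_right hg0
      rw [h2, zero_smul, add_zero] at h
      exact hv0 h
    · rw [map_add, map_smul, hTv', hTu, smul_add, add_assoc, smul_smul, smul_smul, ← add_smul]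
      congr 2
      field_simp
      ring

end Lyapunov

/-! ### The overdamped pair: an indefinite form and the cones of high and low loss -/

section

variable {E : Type*} [NormedAddCommGroup E] [InnerProductSpace ℂ E]

/-- `Ω` and `B` are symmetric, `‖Ω‖ ≤ ω`, `B ≥ b` on `(Ker B)ᗮ`, and `β b > 2 ω`. -/
structure IsOverdamped (Ω B : End ℂ E) (ω b β : ℝ) : Prop where
  symm_Ω : Ω.IsSymmetric
  symm_B : B.IsSymmetric
  ω_pos : 0 < ω
  norm_le : ∀ x, ‖Ω x‖ ≤ ω * ‖x‖
  lower : ∀ x ∈ (LinearMap.ker B)ᗮ, b * ‖x‖ ^ 2 ≤ (inner ℂ x (B x)).re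
  β_pos : 0 < β
  lt : 2 * ω < β * b

namespace IsOverdamped

variable {Ω B : End ℂ E} {ω b β : ℝ}

theorem ratio_pos (h : IsOverdamped Ω B ω b β) : 0 < 2 * ω / (β * b) := by
  have := h.ω_pos
  have := h.lt
  have : 0 < β * b := by linarith
  positivity

theorem ratio_lt_one (h : IsOverdamped Ω B ω b β) : 2 * ω / (β * b) < 1 := by
  have := h.ω_pos
  have := h.lt
  rw [div_lt_one] <;> linarith

end IsOverdamped

variable [FiniteDimensional ℂ E]

theorem finrank_le_finrank_of_forall_ne_zero (f : End ℂ E) {W K : Submodule ℂ E}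
    (hf : ∀ x ∈ W, x ≠ 0 → f x ≠ 0) (hK : ∀ x ∈ W, f x ∈ K) : finrank ℂ W ≤ finrank ℂ K := by
  refine LinearMap.finrank_le_finrank_of_injective (f := f.restrict hK) ?_
  rw [injective_iff_map_eq_zero]
  intro x hx
  by_contra h
  exact hf x x.2 (by simpa using h) (by simpa using congrArg Subtype.val hx)

theorem Submodule.starProjection_toLinearMap_isSymmetric (K : Submodule ℂ E) :
    (K.starProjection.toLinearMap : End ℂ E).IsSymmetric :=
  K.starProjection_isSymmetric

section Indefinite

variable (K : Submodule ℂ E) (s : ℝ)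

/-- The operator of the indefinite form `‖x₁‖² - s² ‖x₂‖²`, where `x = x₁ + x₂` with `x₁ ∈ Kᗮ` and
`x₂ ∈ K`. -/
noncomputable def indefiniteForm : End ℂ E :=
  Kᗮ.starProjection.toLinearMap - ((s ^ 2 : ℝ) : ℂ) • K.starProjection.toLinearMap

theorem indefiniteForm_apply (x : E) :
    indefiniteForm K s x = Kᗮ.starProjection x - ((s ^ 2 : ℝ) : ℂ) • K.starProjection x := rfl

theorem indefiniteForm_isSymmetric : (indefiniteForm K s).IsSymmetric :=
  (Submodule.starProjection_toLinearMap_isSymmetric Kᗮ).sub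
    ((Submodule.starProjection_toLinearMap_isSymmetric K).smul (Complex.conj_ofReal _))

theorem re_inner_indefiniteForm (x : E) : (inner ℂ (indefiniteForm K s x) x).re =
    ‖Kᗮ.starProjection x‖ ^ 2 - s ^ 2 * ‖K.starProjection x‖ ^ 2 := by
  have h1 := Kᗮ.re_inner_starProjection_eq_normSq x
  have h2 := K.re_inner_starProjection_eq_normSq x
  rw [RCLike.re_eq_complex_re] at h1 h2
  rw [indefiniteForm_apply, inner_sub_left, inner_smul_left, Complex.conj_ofReal, Complex.sub_re,
    Complex.re_ofReal_mul, h1, h2]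
  rfl

end Indefinite

namespace IsOverdamped

variable {Ω B : End ℂ E} {ω b β : ℝ}

/-- With `x = y + z`, `y ∈ Kᗮ`, `z ∈ K`, the diagonal parts of `Ω` drop out because `⟪y, Ω y⟫` and
`⟪z, Ω z⟫` are real. The shift `βb/2` leaves at least `(βb/2)(‖y‖² + s²‖z‖²)`, and the cross terms
cost at most `(1 + s²) ω ‖y‖ ‖z‖`. The slope `s = 2ω/(βb)`, that is `ω = s βb/2`, makes the
difference positive. -/
theorem re_inner_indefiniteForm_pos (h : IsOverdamped Ω B ω b β) {x : E} (hx : x ≠ 0) :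
    0 < (inner ℂ (indefiniteForm (LinearMap.ker B) (2 * ω / (β * b)) x)
      ((Complex.I • (Ω - (Complex.I * (β : ℂ)) • B) - ((β * b / 2 : ℝ) : ℂ) • (1 : End ℂ E)) x)).re := by
  have hs0 := h.ratio_pos
  have hs1 := h.ratio_lt_one
  have hω := h.ω_pos
  have hd : 0 < β * b := by linarith [h.lt]
  set s := 2 * ω / (β * b) with hs
  have hsd : s * (β * b) = 2 * ω := div_mul_cancel₀ _ hd.ne'
  set K := LinearMap.ker B
  rw [indefiniteForm_apply]
  set y := Kᗮ.starProjection x with hy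
  set z := K.starProjection x with hz
  have hyK : y ∈ Kᗮ := Kᗮ.starProjection_apply_mem x
  have hzK : z ∈ K := K.starProjection_apply_mem x
  have hxyz : x = z + y := (K.starProjection_add_starProjection_orthogonal x).symm
  have hBz : B z = 0 := hzK
  have hyz : inner ℂ y z = 0 := Submodule.inner_left_of_mem_orthogonal hzK hyK
  have hzy : inner ℂ z y = 0 := Submodule.inner_right_of_mem_orthogonal hzK hyK
  have hzB : inner ℂ z (B y) = 0 := by rw [← h.symm_B z y, hBz, inner_zero_left]
  have hyy : (inner ℂ y (Ω y)).im = 0 := h.symm_Ω.im_inner_self_apply y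
  have hzz : (inner ℂ z (Ω z)).im = 0 := h.symm_Ω.im_inner_self_apply z
  have hcross : (inner ℂ z (Ω y)).im = -(inner ℂ y (Ω z)).im := by
    rw [← h.symm_Ω z y, ← inner_conj_symm, Complex.conj_im]
  have hTx : (Complex.I • (Ω - (Complex.I * (β : ℂ)) • B) - ((β * b / 2 : ℝ) : ℂ) • (1 : End ℂ E)) x
      = Complex.I • Ω y + Complex.I • Ω z + (β : ℂ) • B y - ((β * b / 2 : ℝ) : ℂ) • y
        - ((β * b / 2 : ℝ) : ℂ) • z := by
    have hI : Complex.I * (Complex.I * (β : ℂ)) = -β := by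
      rw [← mul_assoc, Complex.I_mul_I, neg_one_mul]
    rw [hxyz]
    simp only [LinearMap.sub_apply, LinearMap.smul_apply, LinearMap.neg_apply, End.one_apply, map_add, hBz, smul_sub,
      smul_smul, hI, neg_smul, smul_zero]
    abel
  have hexp : (inner ℂ (y - ((s ^ 2 : ℝ) : ℂ) • z) (Complex.I • Ω y + Complex.I • Ω z + (β : ℂ) • B y
      - ((β * b / 2 : ℝ) : ℂ) • y - ((β * b / 2 : ℝ) : ℂ) • z)).re
      = β * (inner ℂ y (B y)).re - β * b / 2 * ‖y‖ ^ 2 + s ^ 2 * (β * b / 2 * ‖z‖ ^ 2)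
        - (1 + s ^ 2) * (inner ℂ y (Ω z)).im := by
    have hy2 : (inner ℂ y y).re = ‖y‖ ^ 2 := (norm_sq_eq_re_inner (𝕜 := ℂ) y).symm
    have hz2 : (inner ℂ z z).re = ‖z‖ ^ 2 := (norm_sq_eq_re_inner (𝕜 := ℂ) z).symm
    simp only [inner_sub_left, inner_sub_right, inner_add_right, inner_smul_left, inner_smul_right,
      Complex.conj_ofReal, Complex.sub_re, Complex.add_re, Complex.re_ofReal_mul, Complex.I_mul_re,
      hyz, hzy, hzB, hyy, hzz, hcross, hy2, hz2, Complex.zero_re, Complex.sub_im,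
      Complex.im_ofReal_mul]
    ring
  rw [hTx, hexp]
  have h1 := h.lower y hyK
  have h2 : (inner ℂ y (Ω z)).im ≤ ‖y‖ * (ω * ‖z‖) :=
    (Complex.abs_im_le_norm _ |>.trans (norm_inner_le_norm _ _) |>.trans
      (mul_le_mul_of_nonneg_left (h.norm_le z) (norm_nonneg _)) |> (le_abs_self _).trans)
  have h3 := mul_le_mul_of_nonneg_left h1 h.β_pos.le
  have h4 := mul_le_mul_of_nonneg_left h2 (by positivity : 0 ≤ 1 + s ^ 2)
  -- This is `‖y‖² + s²‖z‖² - s(1 + s²)‖y‖‖z‖` after completing the square; `s < 1` makes the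
  -- remainder nonnegative.
  have h5 : 0 < (‖y‖ - s * ‖z‖) ^ 2 + s * (1 - s ^ 2) * (‖y‖ * ‖z‖) := by
    have hs2 : 0 < 1 - s ^ 2 := by nlinarith
    by_cases hy0 : y = 0
    · have hz0 : z ≠ 0 := fun hz0 ↦ hx (by rw [hxyz, hy0, hz0, add_zero])
      have := norm_pos_iff.2 hz0
      rw [hy0, norm_zero]
      have : 0 < (0 - s * ‖z‖) ^ 2 := by rw [zero_sub, neg_sq]; positivity
      linarith
    · by_cases hz0 : z = 0
      · have := norm_pos_iff.2 hy0
        rw [hz0, norm_zero]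
        have : 0 < (‖y‖ - s * 0) ^ 2 := by rw [mul_zero, sub_zero]; positivity
        linarith
      · have := norm_pos_iff.2 hy0
        have := norm_pos_iff.2 hz0
        positivity
  have h6 := mul_pos (half_pos hd) h5
  have h7 : ω = s * (β * b) / 2 := by linarith
  rw [h7] at h4
  nlinarith

/-- Lyapunov's argument for `iA - βb/2`, whose eigenvalues on `W` lie in the right half-plane. -/
theorem norm_lt_of_high (h : IsOverdamped Ω B ω b β) {W : Submodule ℂ E}
    (hW : ∀ x ∈ W, (Ω - (Complex.I * (β : ℂ)) • B) x ∈ W)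
    (hspec : ∀ ζ : ℂ, ∀ v ∈ W, v ≠ 0 → (Ω - (Complex.I * (β : ℂ)) • B) v = ζ • v →
      β * b / 2 < -ζ.im) {x : E} (hxW : x ∈ W) (hx : x ≠ 0) :
    2 * ω / (β * b) * ‖(LinearMap.ker B).starProjection x‖ <
      ‖(LinearMap.ker B)ᗮ.starProjection x‖ := by
  have key := re_inner_pos_of_lyapunov (indefiniteForm_isSymmetric (LinearMap.ker B)
    (2 * ω / (β * b))) (Complex.I • (Ω - (Complex.I * (β : ℂ)) • B)
      - ((β * b / 2 : ℝ) : ℂ) • (1 : End ℂ E)) W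
    (fun y hy ↦ W.sub_mem (W.smul_mem _ (hW y hy)) (W.smul_mem _ hy))
    (fun y _ hy ↦ h.re_inner_indefiniteForm_pos hy) ?_ x hxW hx
  · rw [re_inner_indefiniteForm] at key
    have := h.ratio_pos
    exact lt_of_pow_lt_pow_left₀ 2 (norm_nonneg _) (by rw [mul_pow]; linarith)
  · intro ζ v hv hv0 hTv
    -- An eigenvalue `ζ` of `iA - βb/2` comes from the eigenvalue `-i(ζ + βb/2)` of `A`, whose
    -- negated imaginary part is `re ζ + βb/2`.
    have h1 : (Ω - (Complex.I * (β : ℂ)) • B) v = (-Complex.I * (ζ + ((β * b / 2 : ℝ) : ℂ))) • v := by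
      rw [LinearMap.sub_apply, sub_eq_iff_eq_add, LinearMap.smul_apply, LinearMap.smul_apply,
        End.one_apply, ← add_smul] at hTv
      generalize (Ω - (Complex.I * (β : ℂ)) • B) v = w at hTv ⊢
      rw [mul_smul, ← hTv, smul_smul, neg_mul, Complex.I_mul_I, neg_neg, one_smul]
    have h2 := hspec _ v hv hv0 h1
    simp only [neg_mul, Complex.neg_im, Complex.I_mul_im, Complex.add_re, Complex.ofReal_re,
      neg_neg] at h2
    linarith

/-- Both the form and the operator are negated, which preserves the Lyapunov inequality. The
resulting cone bound gives more than a dimension: it controls the error of the compression to `K`.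
-/
theorem norm_lt_of_low (h : IsOverdamped Ω B ω b β) {W : Submodule ℂ E}
    (hW : ∀ x ∈ W, (Ω - (Complex.I * (β : ℂ)) • B) x ∈ W)
    (hspec : ∀ ζ : ℂ, ∀ v ∈ W, v ≠ 0 → (Ω - (Complex.I * (β : ℂ)) • B) v = ζ • v →
      -ζ.im < β * b / 2) {x : E} (hxW : x ∈ W) (hx : x ≠ 0) :
    ‖(LinearMap.ker B)ᗮ.starProjection x‖ <
      2 * ω / (β * b) * ‖(LinearMap.ker B).starProjection x‖ := by
  have key := re_inner_pos_of_lyapunov (J := -indefiniteForm (LinearMap.ker B) (2 * ω / (β * b)))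
    (by
      intro y z
      rw [LinearMap.neg_apply, LinearMap.neg_apply, inner_neg_left, inner_neg_right,
        indefiniteForm_isSymmetric]) (-(Complex.I • (Ω - (Complex.I * (β : ℂ)) • B)
      - ((β * b / 2 : ℝ) : ℂ) • (1 : End ℂ E))) W
    (fun y hy ↦ W.neg_mem (W.sub_mem (W.smul_mem _ (hW y hy)) (W.smul_mem _ hy)))
    (fun y _ hy ↦ by
      rw [LinearMap.neg_apply, LinearMap.neg_apply, inner_neg_neg]
      exact h.re_inner_indefiniteForm_pos hy) ?_ x hxW hx
  · rw [LinearMap.neg_apply, inner_neg_left, Complex.neg_re, re_inner_indefiniteForm] at key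
    have := h.ratio_pos
    exact lt_of_pow_lt_pow_left₀ 2 (by positivity) (by rw [mul_pow]; linarith)
  · intro ζ v hv hv0 hTv
    have h1 : (Ω - (Complex.I * (β : ℂ)) • B) v = (-Complex.I * (-ζ + ((β * b / 2 : ℝ) : ℂ))) • v := by
      rw [LinearMap.neg_apply, neg_eq_iff_eq_neg, LinearMap.sub_apply, sub_eq_iff_eq_add,
        LinearMap.smul_apply, LinearMap.smul_apply, End.one_apply, ← neg_smul, ← add_smul] at hTv
      generalize (Ω - (Complex.I * (β : ℂ)) • B) v = w at hTv ⊢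
      rw [mul_smul, ← hTv, smul_smul, neg_mul, Complex.I_mul_I, neg_neg, one_smul]
    have h2 := hspec _ v hv hv0 h1
    simp only [neg_mul, Complex.neg_im, Complex.I_mul_im, Complex.add_re, Complex.ofReal_re,
      Complex.neg_re, neg_neg] at h2
    linarith

/-- Each cone bound makes one projection injective. The two upper bounds for the dimensions add up
to the dimension of the whole space, so both are equalities. -/
theorem finrank_low_eq (h : IsOverdamped Ω B ω b β) {W₁ W₂ : Submodule ℂ E} (hc : IsCompl W₁ W₂)
    (hW₁ : ∀ x ∈ W₁, (Ω - (Complex.I * (β : ℂ)) • B) x ∈ W₁)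
    (hspec₁ : ∀ ζ : ℂ, ∀ v ∈ W₁, v ≠ 0 → (Ω - (Complex.I * (β : ℂ)) • B) v = ζ • v →
      β * b / 2 < -ζ.im)
    (hW₂ : ∀ x ∈ W₂, (Ω - (Complex.I * (β : ℂ)) • B) x ∈ W₂)
    (hspec₂ : ∀ ζ : ℂ, ∀ v ∈ W₂, v ≠ 0 → (Ω - (Complex.I * (β : ℂ)) • B) v = ζ • v →
      -ζ.im < β * b / 2) :
    finrank ℂ W₂ = finrank ℂ (LinearMap.ker B) := by
  have h1 : finrank ℂ W₂ ≤ finrank ℂ (LinearMap.ker B) := by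
    refine finrank_le_finrank_of_forall_ne_zero (LinearMap.ker B).starProjection.toLinearMap
      (fun x hx hx0 h0 ↦ ?_) fun x _ ↦ (LinearMap.ker B).starProjection_apply_mem x
    have h2 := h.norm_lt_of_low hW₂ hspec₂ hx hx0
    rw [show (LinearMap.ker B).starProjection x = 0 from h0, norm_zero, mul_zero] at h2
    exact absurd h2 (not_lt.2 (norm_nonneg _))
  have h2 : finrank ℂ W₁ ≤ finrank ℂ (LinearMap.ker B)ᗮ := by
    refine finrank_le_finrank_of_forall_ne_zero (LinearMap.ker B)ᗮ.starProjection.toLinearMap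
      (fun x hx hx0 h0 ↦ ?_) fun x _ ↦ (LinearMap.ker B)ᗮ.starProjection_apply_mem x
    have h2 := h.norm_lt_of_high hW₁ hspec₁ hx hx0
    have := h.ratio_pos
    rw [show (LinearMap.ker B)ᗮ.starProjection x = 0 from h0, norm_zero] at h2
    exact absurd h2 (not_lt.2 (by positivity))
  have h3 := Submodule.finrank_add_eq_of_isCompl hc
  have h4 := (LinearMap.ker B).finrank_add_finrank_orthogonal
  omega

end IsOverdamped

end

/-! ### Counting eigenvalues of a perturbed symmetric operator -/

section

variable {E : Type*} [NormedAddCommGroup E] [InnerProductSpace ℂ E] [FiniteDimensional ℂ E]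
  {C : End ℂ E}

theorem LinearMap.IsSymmetric.inner_eq_zero_of_mem_spectralSubspace (hC : C.IsSymmetric) {s : Set ℂ}
    {ζ : ℂ} (hζ : ζ ∉ s) {v x : E} (hv : C v = ζ • v) (hx : x ∈ spectralSubspace C s) :
    inner ℂ v x = 0 := by
  have h1 : spectralSubspace C s ≤ (ℂ ∙ v)ᗮ := by
    refine iSup₂_le fun μ hμ y hy ↦ ?_
    rw [hC.isFinitelySemisimple.maxGenEigenspace_eq_eigenspace] at hy
    rw [Submodule.mem_orthogonal_singleton_iff_inner_right]
    have hne : ζ ≠ μ := fun h ↦ hζ (h ▸ hμ)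
    exact hC.orthogonalFamily_eigenspaces hne ⟨v, End.mem_eigenspace_iff.2 hv⟩ ⟨y, hy⟩
  exact (Submodule.mem_orthogonal_singleton_iff_inner_right).1 (h1 hx)

theorem LinearMap.IsSymmetric.spectralSubspace_re_eq_zero (hC : C.IsSymmetric) :
    spectralSubspace C {ζ | ζ.re = 0} = LinearMap.ker C := by
  apply le_antisymm
  · refine (spectralSubspace_congr C (t := {0}) ?_).trans ?_
    · rintro ζ ⟨h1, h2⟩
      exact Complex.ext h2 (hC.im_eq_zero_of_mem_spectrum h1)
    · refine iSup₂_le fun μ hμ ↦ ?_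
      rw [hC.isFinitelySemisimple.maxGenEigenspace_eq_eigenspace, Set.mem_singleton_iff.1 hμ,
        End.eigenspace_zero]
  · intro x hx
    exact mem_spectralSubspace_of_eigenvector (ζ := 0) (by simp) (by rw [zero_smul]; exact hx)

theorem LinearMap.IsSymmetric.finrank_range_eq (hC : C.IsSymmetric) :
    finrank ℂ (LinearMap.range C) = finrank ℂ (spectralSubspace C {ζ | 0 < ζ.re}) +
      finrank ℂ (spectralSubspace C {ζ | ζ.re < 0}) := by
  have h1 : ({ζ | 0 < ζ.re} ∪ {ζ | ζ.re < 0}) ∪ {ζ : ℂ | ζ.re = 0} = Set.univ := by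
    ext ζ
    rcases lt_trichotomy ζ.re 0 with h | h | h <;> simp [h]
  have h2 : Disjoint {ζ : ℂ | 0 < ζ.re} {ζ | ζ.re < 0} :=
    Set.disjoint_left.2 fun ζ (h : 0 < ζ.re) (h' : ζ.re < 0) ↦ lt_asymm h h'
  have h3 : Disjoint ({ζ : ℂ | 0 < ζ.re} ∪ {ζ | ζ.re < 0}) {ζ : ℂ | ζ.re = 0} :=
    Set.disjoint_left.2 fun ζ h (h' : ζ.re = 0) ↦ by simp [h'] at h
  have h4 := finrank_spectralSubspace_union C h3
  rw [h1, spectralSubspace_univ, finrank_spectralSubspace_union C h2,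
    hC.spectralSubspace_re_eq_zero, finrank_top] at h4
  have h5 := LinearMap.finrank_range_add_finrank_ker C
  omega

/-- Let `A` be, on the subspace `W₁ ⊔ W₂`, a perturbation of size less than `r` of a symmetric
operator `C` without spectrum in `(0, 2 r)`. Then as many eigenvalues of `A` have real part above
`r` as `C` has positive eigenvalues. -/
theorem finrank_eq_finrank_spectralSubspace_pos (hC : C.IsSymmetric) {K : Submodule ℂ E}
    (hCK : ∀ x, C x ∈ K) {A : End ℂ E} {r : ℝ} (hr : 0 < r)
    (hgap : ∀ μ : ℝ, (μ : ℂ) ∈ spectrum ℂ C → μ ≤ 0 ∨ 2 * r ≤ μ) {W W₁ W₂ : Submodule ℂ E}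
    (hW : ∀ x ∈ W, x ≠ 0 →
      ‖K.starProjection (A x) - C (K.starProjection x)‖ < r * ‖K.starProjection x‖)
    (h₁ : W₁ ≤ W) (h₂ : W₂ ≤ W) (hdim : finrank ℂ W₁ + finrank ℂ W₂ = finrank ℂ K)
    (hA₁ : ∀ x ∈ W₁, A x ∈ W₁) (hA₂ : ∀ x ∈ W₂, A x ∈ W₂)
    (hspec₁ : ∀ ζ : ℂ, ∀ v ∈ W₁, v ≠ 0 → A v = ζ • v → r < ζ.re)
    (hspec₂ : ∀ ζ : ℂ, ∀ v ∈ W₂, v ≠ 0 → A v = ζ • v → ζ.re < r) :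
    finrank ℂ W₁ = finrank ℂ (spectralSubspace C {ζ | 0 < ζ.re}) := by
  set P := spectralSubspace C {ζ | 0 < ζ.re} with hP
  let f : End ℂ E := K.starProjection.toLinearMap
  -- The reflection that is `1` on the positive spectral subspace of `C` and `-1` on its complement.
  -- Pulled back by the projection `f`, it gives the form `‖P.starProjection (f x)‖² -
  -- ‖Pᗮ.starProjection (f x)‖²`.
  let R : End ℂ E := P.starProjection.toLinearMap - Pᗮ.starProjection.toLinearMap
  have hf : f.IsSymmetric := Submodule.starProjection_toLinearMap_isSymmetric K
  have hR : R.IsSymmetric := (Submodule.starProjection_toLinearMap_isSymmetric P).sub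
    (Submodule.starProjection_toLinearMap_isSymmetric Pᗮ)
  have hJ : (f * R * f).IsSymmetric := fun x y ↦ by
    simp only [End.mul_apply]
    rw [hf, hR, hf]
  -- The range of `C` lies in `K`, so the symmetric `C` kills `Kᗮ`, and zero modes are orthogonal to
  -- `P`.
  have hPK : P ≤ K := by
    rw [← K.orthogonal_orthogonal]
    intro x hx y hy
    refine hC.inner_eq_zero_of_mem_spectralSubspace (ζ := 0) (by simp) ?_ hx
    rw [zero_smul, ← inner_self_eq_zero (𝕜 := ℂ), hC]
    exact Submodule.inner_left_of_mem_orthogonal (hCK _) hy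
  have hupper : ∀ y ∈ P, 2 * r * ‖y‖ ^ 2 ≤ (inner ℂ y (C y)).re := by
    intro y hy
    refine hC.mul_norm_sq_le_re_inner fun μ v hv hvy ↦ ?_
    have hμ : 0 < μ := by
      by_contra h
      exact hvy (hC.inner_eq_zero_of_mem_spectralSubspace (s := {ζ | 0 < ζ.re}) (by simpa using h)
        hv hy)
    have hv0 : v ≠ 0 := fun h ↦ hvy (by rw [h, inner_zero_left])
    exact (hgap μ (mem_spectrum_iff_exists_eigenvector.2 ⟨v, hv0, hv⟩)).resolve_left (not_le.2 hμ)
  have hlower : ∀ z ∈ Pᗮ, (inner ℂ z (C z)).re ≤ 0 := by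
    intro z hz
    have hC' : (-C).IsSymmetric := fun x y ↦ by
      rw [LinearMap.neg_apply, LinearMap.neg_apply, inner_neg_left, inner_neg_right, hC]
    have h1 := hC'.mul_norm_sq_le_re_inner (m := 0) (x := z) fun μ v hv hvz ↦ by
      by_contra! h
      refine hvz (hz v (mem_spectralSubspace_of_eigenvector (ζ := ((-μ : ℝ) : ℂ)) (by simpa using h)
        ?_))
      rw [← neg_neg (C v), ← LinearMap.neg_apply, hv, Complex.ofReal_neg, neg_smul]
    rw [LinearMap.neg_apply, inner_neg_right, Complex.neg_re, zero_mul] at h1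
    linarith
  have hCP : ∀ y ∈ P, C y ∈ P := apply_mem_spectralSubspace C _
  have hCP' : ∀ z ∈ Pᗮ, C z ∈ Pᗮ := fun z hz y hy ↦ by
    rw [← hC]
    exact hz _ (hCP y hy)
  have hform : ∀ x, (inner ℂ ((f * R * f) x) x).re =
      ‖P.starProjection (f x)‖ ^ 2 - ‖Pᗮ.starProjection (f x)‖ ^ 2 := by
    intro x
    have h1 := P.re_inner_starProjection_eq_normSq (f x)
    have h2 := Pᗮ.re_inner_starProjection_eq_normSq (f x)
    rw [RCLike.re_eq_complex_re] at h1 h2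
    rw [End.mul_apply, End.mul_apply, hf]
    change (inner ℂ (P.starProjection (f x) - Pᗮ.starProjection (f x)) (f x)).re = _
    rw [inner_sub_left, Complex.sub_re, h1, h2]
    rfl
  have hpos : ∀ x ∈ W, x ≠ 0 →
      0 < (inner ℂ ((f * R * f) x) ((A - (r : ℂ) • (1 : End ℂ E)) x)).re := by
    intro x hx hx0
    have herr := hW x hx hx0
    rw [End.mul_apply, End.mul_apply, hf]
    set u := f x with hu
    have hfu : f u = u := by
      rw [hu]
      exact Submodule.starProjection_eq_self_iff.2 (K.starProjection_apply_mem x)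
    have hu0 : 0 < ‖u‖ := by
      by_contra! h
      have h' : ‖K.starProjection x‖ = 0 := le_antisymm h (norm_nonneg _)
      rw [h', mul_zero] at herr
      exact absurd herr (not_lt.2 (norm_nonneg _))
    set y := P.starProjection u with hy
    set z := Pᗮ.starProjection u with hz
    have hyP : y ∈ P := P.starProjection_apply_mem u
    have hzP : z ∈ Pᗮ := Pᗮ.starProjection_apply_mem u
    have huyz : u = y + z := (P.starProjection_add_starProjection_orthogonal u).symm
    have hyz : inner ℂ y z = 0 := hzP y hyP
    have hzy : inner ℂ z y = 0 := by rw [← inner_conj_symm, hyz, map_zero]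
    have hRu : R u = y - z := rfl
    have hnu : ‖u‖ ^ 2 = ‖y‖ ^ 2 + ‖z‖ ^ 2 := by
      rw [huyz, sq, sq, sq, norm_add_sq_eq_norm_sq_add_norm_sq_of_inner_eq_zero (𝕜 := ℂ) y z hyz]
    have hnRu : ‖R u‖ = ‖u‖ := by
      rw [← sq_eq_sq₀ (norm_nonneg _) (norm_nonneg _), hnu, hRu, sub_eq_add_neg, sq, sq, sq,
        norm_add_sq_eq_norm_sq_add_norm_sq_of_inner_eq_zero (𝕜 := ℂ) y (-z)
        (by rw [inner_neg_right, hyz, neg_zero]), norm_neg]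
    set e := K.starProjection (A x) - C (K.starProjection x) with he
    have hfA : f ((A - (r : ℂ) • (1 : End ℂ E)) x) = (C u - (r : ℂ) • u) + e := by
      rw [LinearMap.sub_apply, LinearMap.smul_apply, End.one_apply, map_sub, map_smul, ← hu, he]
      change K.starProjection (A x) - _ = C u - _ + (_ - C u)
      abel
    have hmain : (inner ℂ (R u) (C u - (r : ℂ) • u)).re = (inner ℂ y (C y)).re - r * ‖y‖ ^ 2
        - (inner ℂ z (C z)).re + r * ‖z‖ ^ 2 := by
      have hy2 : (inner ℂ y y).re = ‖y‖ ^ 2 := (norm_sq_eq_re_inner (𝕜 := ℂ) y).symm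
      have hz2 : (inner ℂ z z).re = ‖z‖ ^ 2 := (norm_sq_eq_re_inner (𝕜 := ℂ) z).symm
      have hyCz : inner ℂ y (C z) = 0 := hCP' z hzP y hyP
      have hzCy : inner ℂ z (C y) = 0 := by rw [← inner_conj_symm, hzP _ (hCP y hyP), map_zero]
      rw [hRu, huyz]
      simp only [map_add, inner_sub_left, inner_sub_right, inner_add_right, inner_smul_right,
        Complex.sub_re, Complex.add_re, Complex.re_ofReal_mul, hyz, hzy, hyCz, hzCy, hy2, hz2,
        Complex.zero_re]
      ring
    -- Here `C - r ≥ r` on `P` and `r - C ≥ r` on `Pᗮ`, so the unperturbed term is at least `r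
    -- ‖u‖²`, while the error term is smaller than that in modulus.
    rw [hfA, inner_add_right, Complex.add_re, hmain]
    have h3 : -(‖u‖ * ‖e‖) ≤ (inner ℂ (R u) e).re := by
      have := (Complex.abs_re_le_norm (inner ℂ (R u) e)).trans (norm_inner_le_norm _ _)
      rw [hnRu] at this
      exact neg_le_of_abs_le this
    have h4 : ‖u‖ * ‖e‖ < ‖u‖ * (r * ‖u‖) := mul_lt_mul_of_pos_left herr hu0
    have h5 := hupper y hyP
    have h6 := hlower z hzP
    nlinarith
  -- A vector of `W₁` with zero component in `P` would make the positive definite form nonpositive.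
  have hd₁ : finrank ℂ W₁ ≤ finrank ℂ P := by
    refine finrank_le_finrank_of_forall_ne_zero (P.starProjection.toLinearMap * f)
      (fun x hx hx0 h0 ↦ ?_) fun x _ ↦ P.starProjection_apply_mem (f x)
    have h1 := re_inner_pos_of_lyapunov hJ (A - (r : ℂ) • (1 : End ℂ E)) W₁
      (fun y hy ↦ W₁.sub_mem (hA₁ y hy) (W₁.smul_mem _ hy)) (fun y hy ↦ hpos y (h₁ hy)) ?_ x hx hx0
    · rw [hform, show P.starProjection (f x) = 0 from h0, norm_zero] at h1
      nlinarith [sq_nonneg ‖Pᗮ.starProjection (f x)‖]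
    · intro ζ v hv hv0 hAv
      have h2 := hspec₁ (ζ + r) v hv hv0 (by
        rw [add_smul, ← hAv, LinearMap.sub_apply, LinearMap.smul_apply, End.one_apply,
          sub_add_cancel])
      simpa using h2
  have hd₂ : finrank ℂ W₂ ≤ finrank ℂ (Pᗮ ⊓ K : Submodule ℂ E) := by
    refine finrank_le_finrank_of_forall_ne_zero (Pᗮ.starProjection.toLinearMap * f)
      (fun x hx hx0 h0 ↦ ?_) fun x _ ↦ ⟨Pᗮ.starProjection_apply_mem (f x), ?_⟩
    · have h1 := re_inner_pos_of_lyapunov (J := -(f * R * f)) (fun x y ↦ by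
        rw [LinearMap.neg_apply, LinearMap.neg_apply, inner_neg_left, inner_neg_right, hJ])
        (-(A - (r : ℂ) • (1 : End ℂ E))) W₂
        (fun y hy ↦ W₂.neg_mem (W₂.sub_mem (hA₂ y hy) (W₂.smul_mem _ hy))) (fun y hy hy0 ↦ by
          rw [LinearMap.neg_apply, LinearMap.neg_apply, inner_neg_neg]
          exact hpos y (h₂ hy) hy0) ?_ x hx hx0
      · rw [LinearMap.neg_apply, inner_neg_left, Complex.neg_re, hform,
          show Pᗮ.starProjection (f x) = 0 from h0, norm_zero] at h1
        nlinarith [sq_nonneg ‖P.starProjection (f x)‖]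
      · intro ζ v hv hv0 hAv
        have h2 := hspec₂ (-ζ + r) v hv hv0 (by
          rw [add_smul, neg_smul, ← hAv, LinearMap.neg_apply, neg_neg, LinearMap.sub_apply,
            LinearMap.smul_apply, End.one_apply, sub_add_cancel])
        simpa using h2
    · have h1 : Pᗮ.starProjection (f x) = f x - P.starProjection (f x) :=
        eq_sub_of_add_eq' (P.starProjection_add_starProjection_orthogonal (f x))
      change Pᗮ.starProjection (f x) ∈ K
      rw [h1]
      exact K.sub_mem (K.starProjection_apply_mem x) (hPK (P.starProjection_apply_mem _))
  have h7 := Submodule.finrank_add_inf_finrank_orthogonal hPK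
  omega

end

/-! ### The rank of a compression with an isotropic subspace -/

section Compression

variable {E : Type*} [NormedAddCommGroup E] [InnerProductSpace ℂ E] [FiniteDimensional ℂ E]

/-- The rank of the compression to `K` of a symmetric operator `Ω` that vanishes as a form on
`V ≤ K` and is nondegenerate in the sense that only elements of `V` are `Ω`-orthogonal to `V`. -/
theorem finrank_range_compression {Ω : End ℂ E} (hΩ : Ω.IsSymmetric) {K V : Submodule ℂ E}
    (hVK : V ≤ K) (hV : ∀ v ∈ V, ∀ w ∈ V, inner ℂ v (Ω w) = 0)
    (hK : ∀ u ∈ K, (∀ w ∈ V, inner ℂ w (Ω u) = 0) → u ∈ V) :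
    finrank ℂ (LinearMap.range ((K.starProjection.toLinearMap * Ω * K.starProjection.toLinearMap :
      End ℂ E))) = 2 * (finrank ℂ K - finrank ℂ V) := by
  set C : End ℂ E := K.starProjection.toLinearMap * Ω * K.starProjection.toLinearMap with hC
  have hCK : ∀ x ∈ K, C x = K.starProjection (Ω x) := fun x hx ↦ by
    change K.starProjection (Ω (K.starProjection x)) = _
    rw [Submodule.starProjection_eq_self_iff.2 hx]
  let U : Submodule ℂ E := Vᗮ ⊓ K
  -- Relative to `K = U ⊕ V` the compression has a zero block on `V` and off-diagonal blocks `g` and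
  -- its adjoint. By `hK`, `g` is injective on `U`; so the kernel within `K` is the complement of
  -- `g(U)` in `V`, and the rank is twice the dimension of `U`.
  let g : End ℂ E := V.starProjection.toLinearMap * Ω
  let W : Submodule ℂ E := U.map g
  have hWV : W ≤ V := by
    rintro _ ⟨u, -, rfl⟩
    exact V.starProjection_apply_mem _
  have hg : ∀ u, ∀ w ∈ V, inner ℂ w (g u) = inner ℂ w (Ω u) := fun u w hw ↦ by
    change inner ℂ w (V.starProjection (Ω u)) = _
    rw [← Submodule.inner_starProjection_left_eq_right, Submodule.starProjection_eq_self_iff.2 hw]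
  have hWU : finrank ℂ W = finrank ℂ U := by
    apply le_antisymm (Submodule.finrank_map_le g U)
    refine LinearMap.finrank_le_finrank_of_injective
      (f := g.restrict (p := U) (q := W) fun x hx ↦ Submodule.mem_map_of_mem hx) ?_
    rw [injective_iff_map_eq_zero]
    intro x hx
    have h0 : g x = 0 := by simpa using congrArg Subtype.val hx
    have h1 : (x : E) ∈ V := hK x x.2.2 fun w hw ↦ by rw [← hg x w hw, h0, inner_zero_right]
    exact Subtype.ext (inner_self_eq_zero.1 (x.2.1 _ h1))
  have hker : Kᗮᗮ ⊓ LinearMap.ker C = Wᗮ ⊓ V := by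
    rw [K.orthogonal_orthogonal]
    ext x
    constructor
    · rintro ⟨hxK, hx⟩
      have h0 : ∀ w ∈ K, inner ℂ w (Ω x) = 0 := fun w hw ↦ by
        rw [← Submodule.starProjection_eq_self_iff.2 hw, Submodule.inner_starProjection_left_eq_right,
          ← hCK x hxK, show C x = 0 from hx, inner_zero_right]
      have hxV := hK x hxK fun w hw ↦ h0 w (hVK hw)
      refine ⟨?_, hxV⟩
      rintro _ ⟨u, hu, rfl⟩
      rw [← inner_conj_symm, hg u x hxV, ← hΩ, inner_conj_symm, h0 u hu.2]
    · rintro ⟨hxW, hxV⟩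
      refine ⟨hVK hxV, ?_⟩
      change C x = 0
      rw [hCK x (hVK hxV), Submodule.starProjection_apply_eq_zero_iff]
      intro w hw
      set v := V.starProjection w with hv
      have hvV : v ∈ V := V.starProjection_apply_mem w
      have hu : w - v ∈ U := ⟨V.sub_starProjection_mem_orthogonal w, K.sub_mem hw (hVK hvV)⟩
      have h1 : inner ℂ (w - v) (Ω x) = 0 := by
        rw [← inner_conj_symm, hΩ, ← hg _ x hxV, inner_conj_symm]
        exact hxW _ (Submodule.mem_map_of_mem hu)
      rw [← sub_add_cancel w v, inner_add_left, h1, hV v hvV x hxV, add_zero]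
  have hKC : Kᗮ ≤ LinearMap.ker C := fun x hx ↦ by
    change K.starProjection (Ω (K.starProjection x)) = 0
    rw [(Submodule.starProjection_apply_eq_zero_iff K).2 hx, map_zero, map_zero]
  have h1 := Submodule.finrank_add_inf_finrank_orthogonal hKC
  have h2 := Submodule.finrank_add_inf_finrank_orthogonal hWV
  have h3 : finrank ℂ V + finrank ℂ U = finrank ℂ K :=
    Submodule.finrank_add_inf_finrank_orthogonal hVK
  have h4 := C.finrank_range_add_finrank_ker
  have h5 := K.finrank_add_finrank_orthogonal
  rw [hker] at h1
  omega

end Compression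

/-! ### The matrices of the system: conjugation symmetry, positivity and ranks -/

theorem Matrix.rank_map_ofReal {N : ℕ} (M : Matrix (Fin N) (Fin N) ℝ) :
    (M.map Complex.ofReal).rank = M.rank := by
  -- The invertible real factors of the rank normal form remain invertible over `ℂ`.
  obtain ⟨V, U, e, hV, hU, h⟩ := M.exists_rank_normal_form
  have hmap : ∀ A : Matrix (Fin N) (Fin N) ℝ, A.map Complex.ofReal = Complex.ofRealHom.mapMatrix A :=
    fun _ ↦ rfl
  have h1 := congrArg Complex.ofRealHom.mapMatrix h
  rw [map_mul, map_mul] at h1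
  have hV' : IsUnit (Complex.ofRealHom.mapMatrix V).det :=
    (Matrix.isUnit_iff_isUnit_det _).1 (hV.map Complex.ofRealHom.mapMatrix)
  have hU' : IsUnit (Complex.ofRealHom.mapMatrix U).det :=
    (Matrix.isUnit_iff_isUnit_det _).1 (hU.map Complex.ofRealHom.mapMatrix)
  have h2 : Complex.ofRealHom.mapMatrix ((fromBlocks 1 0 0 0 : Matrix (Fin M.rank ⊕
      Fin (Fintype.card (Fin N) - M.rank)) _ ℝ).submatrix e e) =
      (diagonal (Sum.elim (fun _ ↦ 1) (fun _ ↦ 0)) : Matrix (Fin M.rank ⊕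
      Fin (Fintype.card (Fin N) - M.rank)) _ ℂ).submatrix e e := by
    rw [← fromBlocks_diagonal]
    simp only [RingHom.mapMatrix_apply, ← submatrix_map, fromBlocks_map]
    simp
  rw [hmap, ← rank_mul_eq_right_of_isUnit_det _ _ hV', ← rank_mul_eq_left_of_isUnit_det _ _ hU', h1,
    h2, rank_submatrix, rank_diagonal]
  rw [Fintype.card_congr (Equiv.subtypeSum)]
  simp

namespace LagrangianSystem

variable {N : ℕ} (S : LagrangianSystem N)

/-- Entrywise complex conjugation. -/
noncomputable def conjVec (x : PhaseSpace N) : PhaseSpace N := WithLp.toLp 2 (star x.ofLp)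

theorem conjVec_conjVec (x : PhaseSpace N) : conjVec (conjVec x) = x := by
  ext i; simp [conjVec]

theorem conjVec_zero : conjVec (0 : PhaseSpace N) = 0 := by
  ext i; simp [conjVec]

theorem conjVec_sub (x y : PhaseSpace N) : conjVec (x - y) = conjVec x - conjVec y := by
  ext i; simp [conjVec]

theorem conjVec_neg (x : PhaseSpace N) : conjVec (-x) = -conjVec x := by
  ext i; simp [conjVec]

theorem conjVec_smul (ζ : ℂ) (x : PhaseSpace N) :
    conjVec (ζ • x) = (starRingEnd ℂ ζ) • conjVec x := by
  ext i; simp [conjVec]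

theorem inner_conjVec (x y : PhaseSpace N) :
    inner ℂ (conjVec x) (conjVec y) = starRingEnd ℂ (inner ℂ x y) := by
  simp [conjVec, PiLp.inner_apply]

theorem toEuclideanLin_conjVec (M : Matrix (Fin N ⊕ Fin N) (Fin N ⊕ Fin N) ℂ) (x : PhaseSpace N) :
    Matrix.toEuclideanLin M (conjVec x) = conjVec (Matrix.toEuclideanLin (M.map star) x) := by
  ext i
  simp [conjVec, Matrix.toLpLin_apply, Matrix.mulVec, dotProduct]

/-- Conjugating an eigenvector reflects its eigenvalue in the imaginary axis. For symmetric
operators the spectrum is thus symmetric about `0`, so that `omegaMax` and `rhoMin` also control the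
negative eigenvalues. -/
theorem neg_conj_mem_spectrum {T : End ℂ (PhaseSpace N)} (hT : ∀ x, T (conjVec x) = -conjVec (T x))
    {ζ : ℂ} (hζ : ζ ∈ spectrum ℂ T) : -(starRingEnd ℂ ζ) ∈ spectrum ℂ T := by
  obtain ⟨v, hv0, hv⟩ := mem_spectrum_iff_exists_eigenvector.1 hζ
  refine mem_spectrum_iff_exists_eigenvector.2 ⟨conjVec v, fun h ↦ hv0 ?_, ?_⟩
  · rw [← conjVec_conjVec v, h, conjVec_zero]
  · rw [hT, hv, conjVec_smul, neg_smul]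

/-- Every block of `Ω` is `i` times a real matrix. -/
theorem omega_conjVec (x : PhaseSpace N) : S.Omega (conjVec x) = -conjVec (S.Omega x) := by
  have h : S.OmegaMatrix.map star = -S.OmegaMatrix := by
    have h2 : (starRingEnd ℂ) 2 = 2 := map_ofNat _ 2
    rw [OmegaMatrix, Matrix.fromBlocks_map, Matrix.fromBlocks_neg]
    congr 1 <;> ext i j <;> simp [h2]
  rw [Omega, toEuclideanLin_conjVec, h, map_neg, LinearMap.neg_apply, conjVec_neg]

theorem b_conjVec (x : PhaseSpace N) : S.B (conjVec x) = conjVec (S.B x) := by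
  have h : S.BMatrix.map star = S.BMatrix := by
    rw [BMatrix, Matrix.fromBlocks_map]
    congr 1 <;> ext i j <;> simp
  rw [B, toEuclideanLin_conjVec, h]

theorem projKerB_conjVec (x : PhaseSpace N) : S.projKerB (conjVec x) = conjVec (S.projKerB x) := by
  have hker : ∀ y ∈ LinearMap.ker S.B, conjVec y ∈ LinearMap.ker S.B := fun y hy ↦ by
    rw [LinearMap.mem_ker, b_conjVec, LinearMap.mem_ker.1 hy, conjVec_zero]
  refine Submodule.eq_starProjection_of_mem_orthogonal
    (hker _ ((LinearMap.ker S.B).starProjection_apply_mem x)) ?_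
  rw [← conjVec_sub]
  intro y hy
  have h : inner ℂ (conjVec y) (x - S.projKerB x) = 0 :=
    (LinearMap.ker S.B).sub_starProjection_mem_orthogonal x _ (hker y hy)
  rw [← conjVec_conjVec y, inner_conjVec]
  exact (congrArg _ h).trans (map_zero _)

theorem compressedOmega_conjVec (x : PhaseSpace N) :
    S.compressedOmega (conjVec x) = -conjVec (S.compressedOmega x) := by
  simp only [compressedOmega, End.mul_apply, projKerB_conjVec, omega_conjVec, map_neg]

theorem omega_isSymmetric : S.Omega.IsSymmetric := by
  rw [Omega, Matrix.isSymmetric_toEuclideanLin_iff, OmegaMatrix, Matrix.IsHermitian,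
    Matrix.fromBlocks_conjTranspose]
  have h : (S.Kp * S.θ * S.Kp.transpose).transpose = -(S.Kp * S.θ * S.Kp.transpose) := by
    rw [Matrix.transpose_mul, Matrix.transpose_mul, S.θ_skew, Matrix.transpose_transpose,
      Matrix.mul_assoc, Matrix.neg_mul, Matrix.mul_neg]
  congr 1
  · ext i j
    have hij := congrFun (congrFun h i) j
    rw [Matrix.transpose_apply, Matrix.neg_apply] at hij
    simp [hij]
  · ext i j; simp
  · ext i j; simp
  · simp

open scoped ComplexOrder in
theorem bMatrix_posSemidef : S.BMatrix.PosSemidef := by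
  obtain ⟨Q, hQ⟩ : ∃ Q : Matrix (Fin N) (Fin N) ℝ, S.R = Q.conjTranspose * Q := by
    open scoped MatrixOrder in
    have := CStarAlgebra.nonneg_iff_eq_star_mul_self.mp S.R_posSemidef.nonneg
    exact this
  have h : S.BMatrix = (Matrix.fromBlocks ((Q * S.Kp.transpose).map Complex.ofReal) 0 0
      (0 : Matrix (Fin N) (Fin N) ℂ)).conjTranspose *
      Matrix.fromBlocks ((Q * S.Kp.transpose).map Complex.ofReal) 0 0 0 := by
    have h1 : ((Q * S.Kp.transpose).map Complex.ofReal).conjTranspose =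
        (S.Kp * Q.transpose).map Complex.ofReal := by
      ext i j
      simp [Matrix.mul_apply, mul_comm]
    have h2 : (S.Kp * Q.transpose).map Complex.ofReal * (Q * S.Kp.transpose).map Complex.ofReal =
        (S.Kp * Q.transpose * (Q * S.Kp.transpose)).map Complex.ofReal :=
      (Complex.ofRealHom.mapMatrix.map_mul _ _).symm
    rw [Matrix.fromBlocks_conjTranspose, Matrix.fromBlocks_multiply, h1, h2, BMatrix, hQ,
      Matrix.conjTranspose_eq_transpose_of_trivial]
    simp [Matrix.mul_assoc]
  rw [h]
  exact Matrix.posSemidef_conjTranspose_mul_self _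

open scoped ComplexOrder in
theorem b_isSymmetric : S.B.IsSymmetric :=
  Matrix.isSymmetric_toEuclideanLin_iff.2 S.bMatrix_posSemidef.1

open scoped ComplexOrder in
theorem re_inner_b_nonneg (x : PhaseSpace N) : 0 ≤ (inner ℂ x (S.B x)).re :=
  (Matrix.isPositive_toEuclideanLin_iff.2 S.bMatrix_posSemidef).re_inner_nonneg_right x

theorem compressedOmega_isSymmetric : S.compressedOmega.IsSymmetric := fun x y ↦ by
  have h := Submodule.starProjection_toLinearMap_isSymmetric (LinearMap.ker S.B)
  simp only [compressedOmega, projKerB, End.mul_apply]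
  rw [h, S.omega_isSymmetric, h]

theorem sqrtα_isUnit : IsUnit (psdSqrt S.α) := by
  open scoped MatrixOrder Matrix.Norms.L2Operator in
  exact (CFC.isUnit_sqrt_iff S.α S.α_posDef.posSemidef.nonneg).2 S.α_posDef.isUnit

theorem kp_isUnit : IsUnit S.Kp := (Matrix.isUnit_nonsing_inv_iff).2 S.sqrtα_isUnit

theorem kq_mul_kq : S.Kq * S.Kq = S.η := by
  open scoped MatrixOrder Matrix.Norms.L2Operator in
  exact CFC.sqrt_mul_sqrt_self S.η S.η_posSemidef.nonneg

theorem rank_kp_mul_R_mul_kp :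
    ((S.Kp * S.R * S.Kp.transpose).map Complex.ofReal).rank = S.R.rank := by
  have h := (Matrix.isUnit_iff_isUnit_det _).1 S.kp_isUnit
  rw [Matrix.rank_map_ofReal, Matrix.rank_mul_eq_left_of_isUnit_det _ _ (by
    rwa [Matrix.det_transpose]), Matrix.rank_mul_eq_right_of_isUnit_det _ _ h]

/-- The first component of `ℂ^N ⊕ ℂ^N`. -/
noncomputable def fstL (N : ℕ) : PhaseSpace N →ₗ[ℂ] (Fin N → ℂ) where
  toFun x i := x (Sum.inl i)
  map_add' _ _ := rfl
  map_smul' _ _ := rfl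

theorem fstL_apply (x : PhaseSpace N) : fstL N x = x.ofLp ∘ Sum.inl := rfl

theorem fstL_surjective : Function.Surjective (fstL N) := fun u ↦
  ⟨WithLp.toLp 2 (Sum.elim u 0), rfl⟩

theorem finrank_ker_fstL : finrank ℂ (LinearMap.ker (fstL N)) = N := by
  have h := (fstL N).finrank_range_add_finrank_ker
  rw [LinearMap.range_eq_top.2 fstL_surjective, finrank_top, finrank_euclideanSpace] at h
  simp at h
  omega

theorem mem_ker_b_iff {x : PhaseSpace N} : x ∈ LinearMap.ker S.B ↔
    ((S.Kp * S.R * S.Kp.transpose).map Complex.ofReal).mulVec (fstL N x) = 0 := by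
  rw [LinearMap.mem_ker, B, Matrix.toLpLin_apply, fstL_apply, BMatrix, Matrix.fromBlocks_mulVec]
  constructor
  · intro h
    funext i
    simpa using congrFun (congrArg WithLp.ofLp h) (Sum.inl i)
  · intro h
    ext i
    rcases i with i | i
    · simpa using congrFun h i
    · simp

theorem finrank_ker_b : finrank ℂ (LinearMap.ker S.B) + S.R.rank = 2 * N := by
  set X := (S.Kp * S.R * S.Kp.transpose).map Complex.ofReal with hX
  have h1 : LinearMap.ker S.B = LinearMap.ker (X.mulVecLin ∘ₗ fstL N) := by
    ext x
    rw [S.mem_ker_b_iff]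
    rfl
  have h2 := (X.mulVecLin ∘ₗ fstL N).finrank_range_add_finrank_ker
  rw [LinearMap.range_comp_of_range_eq_top _ (LinearMap.range_eq_top.2 fstL_surjective),
    finrank_euclideanSpace, ← h1] at h2
  have h3 : finrank ℂ (LinearMap.range X.mulVecLin) = S.R.rank := S.rank_kp_mul_R_mul_kp
  rw [h3] at h2
  simp at h2
  omega

/-- The isotropic subspace is `V = 0 ⊕ ℂ^N`: it lies in the kernel of `B`, and the lower right block
of `Ω` is zero. -/
theorem finrank_range_compressedOmega (h : LinearMap.ker (Matrix.toLin' (S.R.map Complex.ofReal)) ⊓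
      LinearMap.ker (Matrix.toLin' (S.η.map Complex.ofReal)) = ⊥) :
    finrank ℂ (LinearMap.range S.compressedOmega) = 2 * (N - S.R.rank) := by
  have hmap : ∀ A B : Matrix (Fin N) (Fin N) ℝ,
      (A * B).map Complex.ofReal = A.map Complex.ofReal * B.map Complex.ofReal :=
    fun A B ↦ Complex.ofRealHom.mapMatrix.map_mul A B
  have hunit : ∀ A : Matrix (Fin N) (Fin N) ℝ, IsUnit A → ∀ u,
      (A.map Complex.ofReal).mulVec u = 0 → u = 0 := fun A hA u hu ↦
    Matrix.mulVec_injective_of_isUnit (hA.map Complex.ofRealHom.mapMatrix)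
      (hu.trans (Matrix.mulVec_zero _).symm)
  have key := finrank_range_compression S.omega_isSymmetric (K := LinearMap.ker S.B)
    (V := LinearMap.ker (fstL N)) ?_ ?_ ?_
  · rw [finrank_ker_fstL] at key
    have h1 := S.finrank_ker_b
    change finrank ℂ (LinearMap.range S.compressedOmega) = _ at key
    omega
  · intro x hx
    rw [S.mem_ker_b_iff, LinearMap.mem_ker.1 hx, Matrix.mulVec_zero]
  · intro v hv w hw
    have hv' : ∀ i, v (Sum.inl i) = 0 := fun i ↦ congrFun hv i
    have hw' : ∀ i, w (Sum.inl i) = 0 := fun i ↦ congrFun hw i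
    simp [Omega, OmegaMatrix, Matrix.toLpLin_apply, PiLp.inner_apply, Matrix.fromBlocks_mulVec, hv',
      Function.comp_def, hw', Matrix.mulVec, dotProduct]
  · intro u hu hw
    have hΦ : (S.Phi.map Complex.ofReal).mulVec (fstL N u) = 0 := by
      funext i
      -- Pairing `Ω u` with the basis vectors of the second summand reads off the entries of `i Φ
      -- u₁`.
      have h1 := hw (EuclideanSpace.single (Sum.inr i) 1) (by
        rw [LinearMap.mem_ker]
        funext j
        simp [fstL_apply])
      rw [EuclideanSpace.inner_single_left, map_one, one_mul, Omega, OmegaMatrix,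
        Matrix.toLpLin_apply, Matrix.fromBlocks_mulVec] at h1
      simpa [Matrix.smul_mulVec, fstL_apply] using h1
    have hu' := S.mem_ker_b_iff.1 hu
    -- With `w = K_pᵀ u₁`, invertibility of `K_p` turns `B u = 0` into `R w = 0`, and `Φ u₁ = 0`
    -- gives `η w = K_q (K_q w) = 0`.
    set w := (S.Kp.transpose.map Complex.ofReal).mulVec (fstL N u) with hwdef
    have h1 : w ∈ LinearMap.ker (Matrix.toLin' (S.R.map Complex.ofReal)) := by
      rw [hmap, hmap, Matrix.mul_assoc, ← Matrix.mulVec_mulVec, ← Matrix.mulVec_mulVec] at hu'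
      exact hunit _ S.kp_isUnit _ hu'
    have h2 : w ∈ LinearMap.ker (Matrix.toLin' (S.η.map Complex.ofReal)) := by
      rw [Phi, hmap, ← Matrix.mulVec_mulVec] at hΦ
      rw [LinearMap.mem_ker, Matrix.toLin'_apply, ← S.kq_mul_kq, hmap, ← Matrix.mulVec_mulVec, hwdef,
        hΦ, Matrix.mulVec_zero]
    have h3 : w = 0 := by
      have : w ∈ (⊥ : Submodule ℂ (Fin N → ℂ)) := h ▸ ⟨h1, h2⟩
      simpa using this
    exact hunit _ ((Matrix.isUnit_transpose _).2 S.kp_isUnit) _ h3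

end LagrangianSystem

theorem spectralSubspace_neg_le {E : Type*} [AddCommGroup E] [Module ℂ E] [FiniteDimensional ℂ E]
    (T : End ℂ E) (s : Set ℂ) :
    spectralSubspace (-T) s ≤ spectralSubspace T (Neg.neg ⁻¹' s) := by
  refine le_spectralSubspace (fun x hx ↦ ?_) fun ζ v hv hv0 hTv ↦ ?_
  · rw [← neg_neg (T x)]
    exact Submodule.neg_mem _ (apply_mem_spectralSubspace (-T) s x hx)
  · change -ζ ∈ s
    exact mem_of_eigenvector_mem_spectralSubspace hv hv0 (by rw [LinearMap.neg_apply, hTv, neg_smul])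

theorem spectralSubspace_neg {E : Type*} [AddCommGroup E] [Module ℂ E] [FiniteDimensional ℂ E]
    (T : End ℂ E) (s : Set ℂ) :
    spectralSubspace (-T) s = spectralSubspace T (Neg.neg ⁻¹' s) := by
  refine (spectralSubspace_neg_le T s).antisymm ?_
  have h := spectralSubspace_neg_le (-T) (Neg.neg ⁻¹' s)
  rwa [neg_neg, ← Set.preimage_comp, neg_comp_neg, Set.preimage_id] at h

/-- The range of `B` is orthogonal to its kernel, so the dissipative term disappears after
projection, whatever `β` is. What remains is `Ω` applied to the component in `Kᗮ`. -/
theorem IsOverdamped.norm_compression_sub_le {E : Type*} [NormedAddCommGroup E]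
    [InnerProductSpace ℂ E] [FiniteDimensional ℂ E] {Ω B : End ℂ E} {ω b β : ℝ}
    (h : IsOverdamped Ω B ω b β) (x : E) :
    ‖(LinearMap.ker B).starProjection ((Ω - (Complex.I * (β : ℂ)) • B) x) -
      ((LinearMap.ker B).starProjection.toLinearMap * Ω *
        (LinearMap.ker B).starProjection.toLinearMap : End ℂ E)
          ((LinearMap.ker B).starProjection x)‖ ≤ ω * ‖(LinearMap.ker B)ᗮ.starProjection x‖ := by
  set K := LinearMap.ker B
  have hB : K.starProjection (B x) = 0 := by
    rw [Submodule.starProjection_apply_eq_zero_iff]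
    intro y hy
    rw [← h.symm_B, LinearMap.mem_ker.1 hy, inner_zero_left]
  have h1 : ((K.starProjection.toLinearMap * Ω * K.starProjection.toLinearMap : End ℂ E))
      (K.starProjection x) = K.starProjection (Ω (K.starProjection x)) := by
    change K.starProjection (Ω (K.starProjection (K.starProjection x))) = _
    rw [Submodule.starProjection_eq_self_iff.2 (K.starProjection_apply_mem x)]
  have h2 : Kᗮ.starProjection x = x - K.starProjection x :=
    eq_sub_of_add_eq' (K.starProjection_add_starProjection_orthogonal x)
  rw [h1, LinearMap.sub_apply, LinearMap.smul_apply, map_sub, map_smul, hB, smul_zero, sub_zero,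
    ← map_sub, ← map_sub, ← h2]
  exact (K.norm_starProjection_apply_le _).trans (h.norm_le _)

/-! ### The constants `omegaMax`, `bMin`, `rhoMin` and `c` -/

namespace LagrangianSystem

variable {N : ℕ} (S : LagrangianSystem N)

theorem finite_real_spectrum (T : End ℂ (PhaseSpace N)) : {x : ℝ | (x : ℂ) ∈ spectrum ℂ T}.Finite :=
  (End.finite_spectrum T).preimage Complex.ofReal_injective.injOn

theorem abs_le_omegaMax {μ : ℝ} (hμ : (μ : ℂ) ∈ spectrum ℂ S.Omega) : |μ| ≤ S.omegaMax := by
  have hle : ∀ x : ℝ, (x : ℂ) ∈ spectrum ℂ S.Omega → x ≤ S.omegaMax := fun x hx ↦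
    le_csSup (finite_real_spectrum _).bddAbove hx
  refine abs_le'.2 ⟨hle μ hμ, hle _ ?_⟩
  have h := neg_conj_mem_spectrum S.omega_conjVec hμ
  rwa [Complex.conj_ofReal, ← Complex.ofReal_neg] at h

theorem omegaMax_nonneg : 0 ≤ S.omegaMax := by
  rcases Set.eq_empty_or_nonempty {x : ℝ | (x : ℂ) ∈ spectrum ℂ S.Omega} with h | ⟨x, hx⟩
  · rw [omegaMax, h, Real.sSup_empty]
  · exact (abs_nonneg x).trans (S.abs_le_omegaMax hx)

theorem norm_omega_le (x : PhaseSpace N) : ‖S.Omega x‖ ≤ S.omegaMax * ‖x‖ :=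
  S.omega_isSymmetric.norm_apply_le S.omegaMax_nonneg (fun _ ↦ S.abs_le_omegaMax) x

theorem exists_ne_zero_mem_spectrum {T : End ℂ (PhaseSpace N)} (hT : T.IsSymmetric) (h0 : T ≠ 0) :
    ∃ x : ℝ, x ≠ 0 ∧ (x : ℂ) ∈ spectrum ℂ T := by
  by_contra! h
  refine h0 (LinearMap.ext fun x ↦ norm_le_zero_iff.1 ?_)
  have := hT.norm_apply_le le_rfl (fun μ hμ ↦ (abs_eq_zero.2 (by_contra fun h' ↦ h μ h' hμ)).le) x
  rwa [zero_mul] at this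

theorem b_ne_zero : S.B ≠ 0 := by
  intro h
  have h1 := S.finrank_ker_b
  rw [h, LinearMap.ker_zero, finrank_top, finrank_euclideanSpace] at h1
  have h2 := S.rank_R_pos
  simp at h1
  omega

theorem bMin_mem : S.bMin ≠ 0 ∧ (S.bMin : ℂ) ∈ spectrum ℂ S.B :=
  Set.Nonempty.csInf_mem (exists_ne_zero_mem_spectrum S.b_isSymmetric S.b_ne_zero)
    ((finite_real_spectrum S.B).subset fun _ hx ↦ hx.2)

theorem bMin_le {μ : ℝ} (hμ0 : μ ≠ 0) (hμ : (μ : ℂ) ∈ spectrum ℂ S.B) : S.bMin ≤ μ :=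
  csInf_le ((finite_real_spectrum S.B).subset fun _ hx ↦ hx.2).bddBelow ⟨hμ0, hμ⟩

theorem bMin_pos : 0 < S.bMin := by
  obtain ⟨v, hv0, hv⟩ := mem_spectrum_iff_exists_eigenvector.1 S.bMin_mem.2
  have h1 := S.re_inner_b_nonneg v
  have h2 : (inner ℂ v v).re = ‖v‖ ^ 2 := (norm_sq_eq_re_inner (𝕜 := ℂ) v).symm
  rw [hv, inner_smul_right, Complex.re_ofReal_mul, h2] at h1
  exact lt_of_le_of_ne (nonneg_of_mul_nonneg_left h1 (pow_pos (norm_pos_iff.2 hv0) 2))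
    S.bMin_mem.1.symm

/-- Only eigenvectors not orthogonal to `x` matter, and those in the kernel of `B` are orthogonal to
it. -/
theorem bMin_mul_norm_sq_le {x : PhaseSpace N} (hx : x ∈ (LinearMap.ker S.B)ᗮ) :
    S.bMin * ‖x‖ ^ 2 ≤ (inner ℂ x (S.B x)).re := by
  refine S.b_isSymmetric.mul_norm_sq_le_re_inner fun μ v hv hvx ↦ S.bMin_le ?_ ?_
  · rintro rfl
    exact hvx (hx v (by rw [LinearMap.mem_ker, hv, Complex.ofReal_zero, zero_smul]))
  · exact mem_spectrum_iff_exists_eigenvector.2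
      ⟨v, fun h ↦ hvx (by rw [h, inner_zero_left]), hv⟩

theorem norm_compressedOmega_le (x : PhaseSpace N) : ‖S.compressedOmega x‖ ≤ S.omegaMax * ‖x‖ :=
  ((LinearMap.ker S.B).norm_starProjection_apply_le _).trans <| (S.norm_omega_le _).trans <|
    mul_le_mul_of_nonneg_left ((LinearMap.ker S.B).norm_starProjection_apply_le x) S.omegaMax_nonneg

theorem rhoMin_le_abs {ρ : ℝ} (hρ0 : ρ ≠ 0) (hρ : (ρ : ℂ) ∈ spectrum ℂ S.compressedOmega) :
    S.rhoMin ≤ |ρ| := by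
  refine csInf_le ((finite_real_spectrum S.compressedOmega).subset fun _ hx ↦ hx.2).bddBelow
    ⟨abs_pos.2 hρ0, ?_⟩
  rcases abs_choice ρ with h | h
  · rwa [h]
  · have h' := neg_conj_mem_spectrum S.compressedOmega_conjVec hρ
    rwa [Complex.conj_ofReal, ← Complex.ofReal_neg, ← h] at h'

theorem rhoMin_mem (hΩ : S.compressedOmega ≠ 0) :
    0 < S.rhoMin ∧ (S.rhoMin : ℂ) ∈ spectrum ℂ S.compressedOmega := by
  have hfin : {x : ℝ | 0 < x ∧ (x : ℂ) ∈ spectrum ℂ S.compressedOmega}.Finite :=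
    (finite_real_spectrum S.compressedOmega).subset fun _ hx ↦ hx.2
  refine Set.Nonempty.csInf_mem ?_ hfin
  obtain ⟨ρ, hρ0, hρ⟩ := exists_ne_zero_mem_spectrum S.compressedOmega_isSymmetric hΩ
  refine ⟨|ρ|, abs_pos.2 hρ0, ?_⟩
  rcases abs_choice ρ with h | h
  · rwa [h]
  · have h' := neg_conj_mem_spectrum S.compressedOmega_conjVec hρ
    rwa [Complex.conj_ofReal, ← Complex.ofReal_neg, ← h] at h'

theorem rhoMin_le_omegaMax (hΩ : S.compressedOmega ≠ 0) : S.rhoMin ≤ S.omegaMax := by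
  obtain ⟨hpos, hmem⟩ := S.rhoMin_mem hΩ
  obtain ⟨v, hv0, hv⟩ := mem_spectrum_iff_exists_eigenvector.1 hmem
  have h := S.norm_compressedOmega_le v
  rw [hv, norm_smul, Complex.norm_real, Real.norm_of_nonneg hpos.le] at h
  exact le_of_mul_le_mul_right h (norm_pos_iff.2 hv0)

theorem two_mul_omegaMax_div_bMin_lt (hΩ : S.compressedOmega ≠ 0) {β : ℝ}
    (hβ : S.cInv (S.rhoMin / 2) < β) : 2 * S.omegaMax / S.bMin < β := by
  have h1 := S.bMin_pos
  have h2 := (S.rhoMin_mem hΩ).1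
  have h3 : 0 ≤ 2 * S.omegaMax ^ 2 / S.bMin * (S.rhoMin / 2)⁻¹ := by positivity
  rw [cInv] at hβ
  linarith

theorem c_lt (hΩ : S.compressedOmega ≠ 0) {β : ℝ} (hβ : S.cInv (S.rhoMin / 2) < β) :
    S.c β < S.rhoMin / 2 := by
  have h0 := S.two_mul_omegaMax_div_bMin_lt hΩ hβ
  have h2 := (S.rhoMin_mem hΩ).1
  rw [cInv, ← lt_sub_iff_add_lt, ← div_eq_mul_inv, div_lt_iff₀ (half_pos h2)] at hβ
  rw [c, ← div_eq_mul_inv, div_lt_iff₀ (by linarith)]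
  linarith

theorem isOverdamped (hΩ : S.compressedOmega ≠ 0) {β : ℝ} (hβ : S.cInv (S.rhoMin / 2) < β) :
    IsOverdamped S.Omega S.B S.omegaMax S.bMin β where
  symm_Ω := S.omega_isSymmetric
  symm_B := S.b_isSymmetric
  ω_pos := (S.rhoMin_mem hΩ).1.trans_le (S.rhoMin_le_omegaMax hΩ)
  norm_le := S.norm_omega_le
  lower _ := S.bMin_mul_norm_sq_le
  β_pos := (div_nonneg (mul_nonneg zero_le_two S.omegaMax_nonneg) S.bMin_pos.le).trans_lt
    (S.two_mul_omegaMax_div_bMin_lt hΩ hβ)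
  lt := (div_lt_iff₀ S.bMin_pos).1 (S.two_mul_omegaMax_div_bMin_lt hΩ hβ)

/-- Clearing denominators, `c(β) = 2ω²/(βb - 2ω)`, while the inertia argument yields the smaller
`2ω²/(βb)`. -/
theorem omegaMax_mul_ratio_le_c {β : ℝ}
    (h : IsOverdamped S.Omega S.B S.omegaMax S.bMin β) :
    S.omegaMax * (2 * S.omegaMax / (β * S.bMin)) ≤ S.c β := by
  have h1 := h.ω_pos
  have h2 := h.lt
  have h3 := S.bMin_pos
  have hc : S.c β = 2 * S.omegaMax ^ 2 / (β * S.bMin - 2 * S.omegaMax) := by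
    have h4 : β * S.bMin - 2 * S.omegaMax ≠ 0 := by linarith
    have h5 : β - 2 * S.omegaMax / S.bMin = (β * S.bMin - 2 * S.omegaMax) / S.bMin := by
      field_simp
    rw [c, h5]
    field_simp
  rw [hc, mul_div_assoc', show S.omegaMax * (2 * S.omegaMax) = 2 * S.omegaMax ^ 2 by ring]
  exact div_le_div_of_nonneg_left (by positivity) (by linarith) (by linarith)

/-! ### Localization of the spectrum of `A(β)` -/

section Localization

variable {S} {β : ℝ}

/-- Dissipativity: for an eigenvector `v`, the imaginary part of `⟪v, A v⟫` is `-β ⟪v, B v⟫`. -/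
theorem neg_im_nonneg (hβ : 0 < β) {ζ : ℂ} (hζ : ζ ∈ spectrum ℂ (S.A β)) : 0 ≤ -ζ.im := by
  obtain ⟨v, hv0, hv⟩ := mem_spectrum_iff_exists_eigenvector.1 hζ
  have h1 := S.re_inner_b_nonneg v
  have h2 : inner ℂ v v = ((‖v‖ ^ 2 : ℝ) : ℂ) := by
    rw [inner_self_eq_norm_sq_to_K]; norm_num
  have h3 : (inner ℂ v (S.Omega v)).im = 0 := S.omega_isSymmetric.im_inner_self_apply v
  have h4 : (inner ℂ v (S.A β v)).im = -(β * (inner ℂ v (S.B v)).re) := by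
    rw [A, LinearMap.sub_apply, LinearMap.smul_apply, inner_sub_right, inner_smul_right,
      Complex.sub_im, h3, mul_assoc, Complex.I_mul_im, Complex.re_ofReal_mul, zero_sub]
  rw [hv, inner_smul_right, h2, mul_comm, Complex.im_ofReal_mul] at h4
  have h5 : 0 ≤ -ζ.im * ‖v‖ ^ 2 := by nlinarith [mul_nonneg hβ.le h1]
  exact nonneg_of_mul_nonneg_left h5 (pow_pos (norm_pos_iff.2 hv0) 2)

/-- An eigenvector of `A` is an approximate eigenvector of the normal operator `-iβ B`, with error
`Ω v`. -/
theorem spectrum_eq_union : spectrum ℂ (S.A β) = S.spectrumZero β ∪ S.spectrumOne β := by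
  apply Set.Subset.antisymm
  · intro ζ hζ
    obtain ⟨v, hv0, hv⟩ := mem_spectrum_iff_exists_eigenvector.1 hζ
    have h1 : ‖(Complex.I * (β : ℂ)) • S.B v + ζ • v‖ ≤ S.omegaMax * ‖v‖ := by
      rw [← hv, A, LinearMap.sub_apply, LinearMap.smul_apply, add_sub_cancel]
      exact S.norm_omega_le v
    obtain ⟨b, hb, hbζ⟩ := S.b_isSymmetric.exists_mem_spectrum_norm_le hv0 h1
    by_cases hb0 : b = 0
    · left
      refine ⟨hζ, ?_⟩
      rw [hb0, Complex.ofReal_zero, mul_zero, zero_add] at hbζ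
      rwa [mem_closedBall_zero_iff]
    · right
      refine ⟨hζ, Set.mem_biUnion (x := (b : ℂ)) ⟨hb, by simpa using hb0⟩ ?_⟩
      rwa [mem_closedBall_iff_norm, sub_neg_eq_add, add_comm]
  · exact Set.union_subset Set.inter_subset_left Set.inter_subset_left

theorem neg_im_ge_of_mem_spectrumOne (h : IsOverdamped S.Omega S.B S.omegaMax S.bMin β)
    {ζ : ℂ} (hζ : ζ ∈ S.spectrumOne β) :
    β * S.bMin - S.omegaMax ≤ -ζ.im ∧ |ζ.re| ≤ S.omegaMax := by
  obtain ⟨-, hζ⟩ := hζ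
  simp only [Set.mem_iUnion] at hζ
  obtain ⟨b, ⟨hb, hb0⟩, hbζ⟩ := hζ
  have hre := S.b_isSymmetric.ofReal_re_of_mem_spectrum hb
  rw [← hre] at hb hb0 hbζ
  have hb' := S.bMin_le (by simpa using hb0) hb
  rw [mem_closedBall_iff_norm, sub_neg_eq_add] at hbζ
  have h1 := (Complex.abs_im_le_norm _).trans hbζ
  have h2 := (Complex.abs_re_le_norm _).trans hbζ
  rw [mul_assoc, Complex.add_im, Complex.I_mul_im, Complex.re_ofReal_mul, Complex.ofReal_re] at h1
  rw [mul_assoc, Complex.add_re, Complex.I_mul_re, Complex.im_ofReal_mul, Complex.ofReal_im,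
    mul_zero, neg_zero, add_zero] at h2
  have h3 := mul_le_mul_of_nonneg_left hb' h.β_pos.le
  exact ⟨by linarith [(abs_le.1 h1).2], h2⟩

theorem neg_im_le_of_mem_spectrumZero {ζ : ℂ} (hζ : ζ ∈ S.spectrumZero β) :
    -ζ.im ≤ S.omegaMax :=
  (neg_le_abs _).trans ((Complex.abs_im_le_norm ζ).trans (mem_closedBall_zero_iff.1 hζ.2))

theorem disjoint_spectrumZero_spectrumOne (h : IsOverdamped S.Omega S.B S.omegaMax S.bMin β) :
    Disjoint (S.spectrumZero β) (S.spectrumOne β) :=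
  Set.disjoint_left.2 fun ζ h0 h1 ↦ by
    have h2 := neg_im_le_of_mem_spectrumZero h0
    have h3 := (neg_im_ge_of_mem_spectrumOne h h1).1
    linarith [h.lt]

end Localization

end LagrangianSystem

/-! ### The loss splitting and the splitting of the low-loss subspace -/

namespace LagrangianSystem

variable {N : ℕ} {S : LagrangianSystem N} {β : ℝ}

theorem existsUnique_isLossSplitting (h : IsOverdamped S.Omega S.B S.omegaMax S.bMin β) :
    S.IsLossSplitting β (spectralSubspace (S.A β) (S.spectrumOne β))
        (spectralSubspace (S.A β) (S.spectrumZero β)) ∧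
      ∀ Hhl Hll, S.IsLossSplitting β Hhl Hll →
        Hhl = spectralSubspace (S.A β) (S.spectrumOne β) ∧
          Hll = spectralSubspace (S.A β) (S.spectrumZero β) := by
  have hdisj := disjoint_spectralSubspace (S.A β) (disjoint_spectrumZero_spectrumOne h).symm
  refine ⟨⟨⟨hdisj, ?_⟩, hasRestrictedSpectrum_spectralSubspace Set.inter_subset_left,
    hasRestrictedSpectrum_spectralSubspace Set.inter_subset_left⟩, fun Hhl Hll H ↦ ?_⟩
  · rw [codisjoint_iff, ← spectralSubspace_union, Set.union_comm, ← spectrum_eq_union, eq_top_iff,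
      ← spectralSubspace_univ (S.A β)]
    exact spectralSubspace_congr _ Set.inter_subset_left
  · refine eq_and_eq_of_le_of_le_of_sup_eq H.spectrum_high.le_spectralSubspace
      H.spectrum_low.le_spectralSubspace hdisj ?_
    rw [H.isCompl.sup_eq_top]
    exact le_top

/-- The compression error `ω ‖x₁‖` combined with the cone bound `‖x₁‖ < s ‖x₂‖`. -/
theorem norm_lt_of_mem_low (h : IsOverdamped S.Omega S.B S.omegaMax S.bMin β) {x : PhaseSpace N}
    (hx : x ∈ spectralSubspace (S.A β) (S.spectrumZero β)) (hx0 : x ≠ 0) :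
    ‖(LinearMap.ker S.B).starProjection (S.A β x) -
      S.compressedOmega ((LinearMap.ker S.B).starProjection x)‖ <
        S.omegaMax * (2 * S.omegaMax / (β * S.bMin)) * ‖(LinearMap.ker S.B).starProjection x‖ := by
  refine (h.norm_compression_sub_le x).trans_lt ?_
  rw [mul_assoc]
  refine mul_lt_mul_of_pos_left (h.norm_lt_of_low (apply_mem_spectralSubspace (S.A β) _)
    (fun ζ v hv hv0 hTv ↦ ?_) hx hx0) h.ω_pos
  have := neg_im_le_of_mem_spectrumZero (mem_of_eigenvector_mem_spectralSubspace hv hv0 hTv)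
  linarith [h.lt]

theorem finrank_low (h : IsOverdamped S.Omega S.B S.omegaMax S.bMin β) :
    finrank ℂ (spectralSubspace (S.A β) (S.spectrumZero β)) = finrank ℂ (LinearMap.ker S.B) := by
  refine h.finrank_low_eq (existsUnique_isLossSplitting h).1.isCompl
    (apply_mem_spectralSubspace (S.A β) _) (fun ζ v hv hv0 hTv ↦ ?_)
    (apply_mem_spectralSubspace (S.A β) _) fun ζ v hv hv0 hTv ↦ ?_
  · have := (neg_im_ge_of_mem_spectrumOne h
      (mem_of_eigenvector_mem_spectralSubspace hv hv0 hTv)).1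
    linarith [h.lt]
  · have := neg_im_le_of_mem_spectrumZero (mem_of_eigenvector_mem_spectralSubspace hv hv0 hTv)
    linarith [h.lt]

/-- The projection of a low-loss eigenvector to the kernel of `B` is nonzero and is an approximate
eigenvector of the symmetric compression. -/
theorem exists_near_of_mem_spectrumZero (h : IsOverdamped S.Omega S.B S.omegaMax S.bMin β) {ζ : ℂ}
    (hζ : ζ ∈ S.spectrumZero β) :
    ∃ ρ : ℝ, (ρ : ℂ) ∈ spectrum ℂ S.compressedOmega ∧ ‖ζ - ρ‖ ≤ S.c β := by
  obtain ⟨v, hv0, hv⟩ := mem_spectrum_iff_exists_eigenvector.1 hζ.1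
  have h1 := norm_lt_of_mem_low h (mem_spectralSubspace_of_eigenvector hζ hv) hv0
  have hp0 : (LinearMap.ker S.B).starProjection v ≠ 0 := by
    intro h0
    rw [h0, norm_zero, mul_zero] at h1
    exact absurd h1 (not_lt.2 (norm_nonneg _))
  rw [hv, map_smul, norm_sub_rev, sub_eq_add_neg, ← neg_smul] at h1
  have h2 := h1.le.trans (mul_le_mul_of_nonneg_right (omegaMax_mul_ratio_le_c S h)
    (norm_nonneg ((LinearMap.ker S.B).starProjection v)))
  obtain ⟨ρ, hρ, hρζ⟩ := S.compressedOmega_isSymmetric.exists_mem_spectrum_norm_le (a := 1)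
    (z := -ζ) hp0 (by rwa [one_smul])
  refine ⟨ρ, hρ, ?_⟩
  rwa [norm_sub_rev, sub_eq_add_neg, ← one_mul (ρ : ℂ)]

/-- The number of low-loss eigenvalues with real part above `rhoMin / 2` or below `-rhoMin / 2`. -/
theorem finrank_low_re (hΩ : S.compressedOmega ≠ 0) (hβ : S.cInv (S.rhoMin / 2) < β) {s t : Set ℂ}
    (hst : s ∪ t = S.spectrumZero β) {σ : ℝ} (hσ : σ = 1 ∨ σ = -1)
    (hs : ∀ ζ ∈ s, S.rhoMin / 2 < σ * ζ.re) (ht : ∀ ζ ∈ t, σ * ζ.re < S.rhoMin / 2) :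
    finrank ℂ (spectralSubspace (S.A β) s) =
      finrank ℂ (spectralSubspace S.compressedOmega {ζ | 0 < σ * ζ.re}) := by
  have h := S.isOverdamped hΩ hβ
  have hr := (S.rhoMin_mem hΩ).1
  have hbound : ∀ x ∈ spectralSubspace (S.A β) (S.spectrumZero β), x ≠ 0 →
      ‖(LinearMap.ker S.B).starProjection (S.A β x) -
        S.compressedOmega ((LinearMap.ker S.B).starProjection x)‖ <
          S.rhoMin / 2 * ‖(LinearMap.ker S.B).starProjection x‖ := fun x hx hx0 ↦
    (norm_lt_of_mem_low h hx hx0).trans_le (mul_le_mul_of_nonneg_right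
      ((omegaMax_mul_ratio_le_c S h).trans (S.c_lt hΩ hβ).le) (norm_nonneg _))
  have hCK : ∀ x, S.compressedOmega x ∈ LinearMap.ker S.B := fun x ↦
    (LinearMap.ker S.B).starProjection_apply_mem _
  have hdisj : Disjoint s t := Set.disjoint_left.2 fun ζ h1 h2 ↦ (hs ζ h1).not_gt (ht ζ h2)
  have hdim := finrank_spectralSubspace_union (S.A β) hdisj
  rw [hst, finrank_low h] at hdim
  have hle₁ : spectralSubspace (S.A β) s ≤ spectralSubspace (S.A β) (S.spectrumZero β) :=
    spectralSubspace_mono _ (hst ▸ Set.subset_union_left)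
  have hle₂ : spectralSubspace (S.A β) t ≤ spectralSubspace (S.A β) (S.spectrumZero β) :=
    spectralSubspace_mono _ (hst ▸ Set.subset_union_right)
  have hgap : ∀ μ : ℝ, (μ : ℂ) ∈ spectrum ℂ S.compressedOmega → μ ≤ 0 ∨ 2 * (S.rhoMin / 2) ≤ μ := by
    intro μ hμ
    by_contra! hcon
    have := S.rhoMin_le_abs hcon.1.ne' hμ
    rw [abs_of_pos hcon.1] at this
    linarith
  rcases hσ with rfl | rfl
  · simp only [one_mul] at hs ht
    rw [show {ζ : ℂ | 0 < 1 * ζ.re} = {ζ | 0 < ζ.re} by simp only [one_mul]]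
    exact finrank_eq_finrank_spectralSubspace_pos S.compressedOmega_isSymmetric hCK (half_pos hr)
      hgap hbound hle₁ hle₂ hdim.symm
      (apply_mem_spectralSubspace _ _) (apply_mem_spectralSubspace _ _)
      (fun ζ v hv hv0 hTv ↦ hs _ (mem_of_eigenvector_mem_spectralSubspace hv hv0 hTv))
      (fun ζ v hv hv0 hTv ↦ ht _ (mem_of_eigenvector_mem_spectralSubspace hv hv0 hTv))
  · simp only [neg_one_mul] at hs ht
    have hneg : ∀ {ζ : ℂ} {v : PhaseSpace N}, (-S.A β) v = ζ • v → S.A β v = (-ζ) • v :=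
      fun {ζ v} hv ↦ by rw [neg_smul, ← hv, LinearMap.neg_apply, neg_neg]
    -- Eigenvalues to the left are those to the right for `-A` and `-C`; the gap of `-C` comes from
    -- the symmetry of the spectrum of `C` about `0`.
    have key := finrank_eq_finrank_spectralSubspace_pos (C := -S.compressedOmega) (A := -S.A β)
      (fun x y ↦ by
        rw [LinearMap.neg_apply, LinearMap.neg_apply, inner_neg_left, inner_neg_right,
          S.compressedOmega_isSymmetric])
      (fun x ↦ Submodule.neg_mem _ (hCK x)) (half_pos hr) (fun μ hμ ↦ ?_)
      (fun x hx hx0 ↦ ?_) hle₁ hle₂ hdim.symm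
      (fun x hx ↦ Submodule.neg_mem _ (apply_mem_spectralSubspace _ _ x hx))
      (fun x hx ↦ Submodule.neg_mem _ (apply_mem_spectralSubspace _ _ x hx))
      (fun ζ v hv hv0 hTv ↦ ?_) (fun ζ v hv hv0 hTv ↦ ?_)
    · have hset : Neg.neg ⁻¹' {ζ : ℂ | 0 < ζ.re} = {ζ | 0 < -1 * ζ.re} := by
        ext ζ
        simp
      rw [key, spectralSubspace_neg, hset]
    · refine hgap μ ?_
      obtain ⟨v, hv0, hv⟩ := mem_spectrum_iff_exists_eigenvector.1 hμ
      have h1 : ((-μ : ℝ) : ℂ) ∈ spectrum ℂ S.compressedOmega :=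
        mem_spectrum_iff_exists_eigenvector.2 ⟨v, hv0, by
          rw [Complex.ofReal_neg, neg_smul, ← hv, LinearMap.neg_apply, neg_neg]⟩
      have h2 := neg_conj_mem_spectrum S.compressedOmega_conjVec h1
      rwa [Complex.conj_ofReal, ← Complex.ofReal_neg, neg_neg] at h2
    · have h1 := hbound x hx hx0
      rw [← norm_neg, neg_sub] at h1
      rwa [LinearMap.neg_apply, LinearMap.neg_apply, map_neg, neg_sub_neg]
    · simpa using hs _ (mem_of_eigenvector_mem_spectralSubspace hv hv0 (hneg hTv))
    · simpa using ht _ (mem_of_eigenvector_mem_spectralSubspace hv hv0 (hneg hTv))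

/-- Points of the discs about the nonzero eigenvalues of the compression have real part of modulus
at least `rhoMin - r`. -/
theorem abs_re_of_mem_rhoDiscs {r : ℝ} {ζ : ℂ} (hζ : ζ ∈ S.rhoDiscs r) :
    S.rhoMin - r ≤ |ζ.re| ∧ |ζ.im| ≤ r := by
  simp only [rhoDiscs, Set.mem_iUnion] at hζ
  obtain ⟨ρ, ⟨hρ, hρ0⟩, hρζ⟩ := hζ
  have hre := S.compressedOmega_isSymmetric.ofReal_re_of_mem_spectrum hρ
  rw [← hre] at hρ hρ0 hρζ
  rw [mem_closedBall_iff_norm] at hρζ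
  have h1 := (Complex.abs_re_le_norm _).trans hρζ
  have h2 := (Complex.abs_im_le_norm _).trans hρζ
  rw [Complex.sub_re, Complex.ofReal_re] at h1
  rw [Complex.sub_im, Complex.ofReal_im, sub_zero] at h2
  have h3 := S.rhoMin_le_abs (by simpa using hρ0) hρ
  have h4 := abs_sub_abs_le_abs_sub ρ.re ζ.re
  rw [abs_sub_comm] at h4
  exact ⟨by linarith, h2⟩

theorem spectrumZero_eq_union (hΩ : S.compressedOmega ≠ 0) (hβ : S.cInv (S.rhoMin / 2) < β) :
    S.spectrumZero β = (spectrum ℂ (S.A β) ∩ Metric.closedBall 0 (S.c β)) ∪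
      (spectrum ℂ (S.A β) ∩ S.rhoDiscs (S.c β)) := by
  have h := S.isOverdamped hΩ hβ
  have hc := S.c_lt hΩ hβ
  have hρω := S.rhoMin_le_omegaMax hΩ
  have hr := (S.rhoMin_mem hΩ).1
  ext ζ
  constructor
  · intro hζ
    obtain ⟨ρ, hρ, hρζ⟩ := exists_near_of_mem_spectrumZero h hζ
    by_cases hρ0 : ρ = 0
    · left
      rw [hρ0, Complex.ofReal_zero, sub_zero] at hρζ
      exact ⟨hζ.1, mem_closedBall_zero_iff.2 hρζ⟩
    · right
      exact ⟨hζ.1, Set.mem_biUnion (x := (ρ : ℂ)) ⟨hρ, by simpa using hρ0⟩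
        (mem_closedBall_iff_norm.2 hρζ)⟩
  · rintro (⟨hζ, hζc⟩ | ⟨hζ, hζc⟩)
    · exact ⟨hζ, Metric.closedBall_subset_closedBall (by linarith) hζc⟩
    · have h1 := abs_re_of_mem_rhoDiscs hζc
      have h2 := hζ
      rw [spectrum_eq_union] at h2
      -- The discs about `ρ` may stick out of the disc of radius `ω`, so their eigenvalues are
      -- recognized as low-loss by the imaginary part: `|im ζ| ≤ c(β) < ω`, whereas high loss forces
      -- `-im ζ > ω`.
      refine h2.resolve_right fun h3 ↦ ?_
      have h4 := (neg_im_ge_of_mem_spectrumOne h h3).1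
      linarith [h.lt, neg_le_abs ζ.im]

theorem disjoint_lowLoss (hΩ : S.compressedOmega ≠ 0) (hβ : S.cInv (S.rhoMin / 2) < β) :
    Disjoint (spectrum ℂ (S.A β) ∩ Metric.closedBall 0 (S.c β))
      (spectrum ℂ (S.A β) ∩ S.rhoDiscs (S.c β)) :=
  Set.disjoint_left.2 fun ζ h1 h2 ↦ by
    have h3 := (abs_re_of_mem_rhoDiscs h2.2).1
    have h4 := (Complex.abs_re_le_norm ζ).trans (mem_closedBall_zero_iff.1 h1.2)
    linarith [S.c_lt hΩ hβ]

theorem existsUnique_isLowLossSplitting (hΩ : S.compressedOmega ≠ 0)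
    (hβ : S.cInv (S.rhoMin / 2) < β) :
    S.IsLowLossSplitting β (spectralSubspace (S.A β) (S.spectrumZero β))
      (spectralSubspace (S.A β) (spectrum ℂ (S.A β) ∩ Metric.closedBall 0 (S.c β)))
      (spectralSubspace (S.A β) (spectrum ℂ (S.A β) ∩ S.rhoDiscs (S.c β))) ∧
    ∀ H0 H1, S.IsLowLossSplitting β (spectralSubspace (S.A β) (S.spectrumZero β)) H0 H1 →
      H0 = spectralSubspace (S.A β) (spectrum ℂ (S.A β) ∩ Metric.closedBall 0 (S.c β)) ∧
      H1 = spectralSubspace (S.A β) (spectrum ℂ (S.A β) ∩ S.rhoDiscs (S.c β)) := by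
  have hdisj := disjoint_spectralSubspace (S.A β) (disjoint_lowLoss hΩ hβ)
  have hsup := spectralSubspace_union (S.A β) (spectrum ℂ (S.A β) ∩ Metric.closedBall 0 (S.c β))
    (spectrum ℂ (S.A β) ∩ S.rhoDiscs (S.c β))
  rw [← spectrumZero_eq_union hΩ hβ] at hsup
  refine ⟨⟨hsup.symm, hdisj, hasRestrictedSpectrum_spectralSubspace Set.inter_subset_left,
    hasRestrictedSpectrum_spectralSubspace Set.inter_subset_left⟩, fun H0 H1 H ↦ ?_⟩
  refine eq_and_eq_of_le_of_le_of_sup_eq H.spectrum_zero.le_spectralSubspace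
    H.spectrum_one.le_spectralSubspace hdisj ?_
  rw [← hsup, H.sup_eq]

/-- The eigenvalues in these discs are the low-loss ones with `|re ζ| > rhoMin / 2`. The two signs
of the real part are counted separately and correspond to the positive and negative eigenvalues of
the compression. -/
theorem finrank_lowLoss_one (hΩ : S.compressedOmega ≠ 0) (hβ : S.cInv (S.rhoMin / 2) < β) :
    finrank ℂ (spectralSubspace (S.A β) (spectrum ℂ (S.A β) ∩ S.rhoDiscs (S.c β))) =
      finrank ℂ (LinearMap.range S.compressedOmega) := by
  have hr := (S.rhoMin_mem hΩ).1
  have hc := S.c_lt hΩ hβ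
  have hzero := spectrumZero_eq_union hΩ hβ
  set s := spectrum ℂ (S.A β) ∩ S.rhoDiscs (S.c β) with hs
  have hs' : s = (S.spectrumZero β ∩ {ζ | S.rhoMin / 2 < 1 * ζ.re}) ∪
      (S.spectrumZero β ∩ {ζ | S.rhoMin / 2 < -1 * ζ.re}) := by
    ext ζ
    constructor
    · intro hζ
      have hζ0 : ζ ∈ S.spectrumZero β := hzero ▸ Or.inr hζ
      have h3 := (abs_re_of_mem_rhoDiscs hζ.2).1
      rcases abs_choice ζ.re with h | h <;> rw [h] at h3
      · exact Or.inl ⟨hζ0, by rw [Set.mem_ofPred_eq]; linarith⟩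
      · exact Or.inr ⟨hζ0, by rw [Set.mem_ofPred_eq]; linarith⟩
    · rintro (⟨hζ, h1⟩ | ⟨hζ, h1⟩) <;> rw [hzero] at hζ <;> refine hζ.resolve_left fun h2 ↦ ?_ <;>
        have h4 := (Complex.abs_re_le_norm ζ).trans (mem_closedBall_zero_iff.1 h2.2) <;>
        rw [Set.mem_ofPred_eq] at h1
      · linarith [le_abs_self ζ.re]
      · linarith [neg_le_abs ζ.re]
  have hpart : ∀ σ : ℝ, σ = 1 ∨ σ = -1 →
      finrank ℂ (spectralSubspace (S.A β) (S.spectrumZero β ∩ {ζ | S.rhoMin / 2 < σ * ζ.re})) =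
        finrank ℂ (spectralSubspace S.compressedOmega {ζ | 0 < σ * ζ.re}) := by
    intro σ hσ
    refine finrank_low_re hΩ hβ (t := S.spectrumZero β \ {ζ | S.rhoMin / 2 < σ * ζ.re})
      (Set.inter_union_sdiff _ _) hσ (fun ζ hζ ↦ hζ.2) fun ζ hζ ↦ ?_
    -- No low-loss eigenvalue lies on the dividing line: `|re ζ|` is either at most `c(β) < rhoMin /
    -- 2` or at least `rhoMin - c(β) > rhoMin / 2`.
    refine lt_of_le_of_ne (not_lt.1 hζ.2) fun heq ↦ ?_
    have hζ0 := hζ.1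
    rw [hzero] at hζ0
    have habs : |ζ.re| = S.rhoMin / 2 := by
      rw [← heq]
      rcases hσ with rfl | rfl
      · rw [one_mul] at heq ⊢
        exact abs_of_pos (by linarith)
      · rw [neg_one_mul] at heq ⊢
        exact abs_of_neg (by linarith)
    rcases hζ0 with h1 | h1
    · have h4 := (Complex.abs_re_le_norm ζ).trans (mem_closedBall_zero_iff.1 h1.2)
      linarith
    · linarith [(abs_re_of_mem_rhoDiscs h1.2).1]
  have hdisj : Disjoint (S.spectrumZero β ∩ {ζ | S.rhoMin / 2 < 1 * ζ.re})
      (S.spectrumZero β ∩ {ζ | S.rhoMin / 2 < -1 * ζ.re}) :=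
    Set.disjoint_left.2 fun ζ h1 h2 ↦ by
      have h3 := h1.2
      have h4 := h2.2
      rw [Set.mem_ofPred_eq] at h3 h4
      linarith
  rw [hs', finrank_spectralSubspace_union _ hdisj, hpart 1 (Or.inl rfl), hpart (-1) (Or.inr rfl),
    S.compressedOmega_isSymmetric.finrank_range_eq,
    show {ζ : ℂ | 0 < 1 * ζ.re} = {ζ | 0 < ζ.re} by simp only [one_mul],
    show {ζ : ℂ | 0 < -1 * ζ.re} = {ζ | ζ.re < 0} by simp only [neg_one_mul, neg_pos]]

end LagrangianSystem

/-! ### Assembly of the modal dichotomy -/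

theorem HasRestrictedSpectrum.congr {N : ℕ} {T : Module.End ℂ (PhaseSpace N)}
    {W : Submodule ℂ (PhaseSpace N)} {s t : Set ℂ} (h : HasRestrictedSpectrum T W s) (hst : s = t) :
    HasRestrictedSpectrum T W t :=
  hst ▸ h

theorem mainTheorem9 {N : ℕ} (S : LagrangianSystem N)
    (hN : S.R.rank < N) (hΩ : S.compressedOmega ≠ 0)
    (β : ℝ) (hβ : S.cInv (S.rhoMin / 2) < β) :
    -- the elementary inequalities
    2 * S.omegaMax / S.bMin < β ∧
    S.c β < S.rhoMin / 2 ∧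
    S.rhoMin / 2 ≤ S.omegaMax / 2 ∧
    -- splitting of the spectrum of `A(β)`
    spectrum ℂ (S.A β) = S.spectrumZero β ∪ S.spectrumOne β ∧
    Disjoint (S.spectrumZero β) (S.spectrumOne β) ∧
    -- existence and uniqueness of the high-loss and low-loss subspaces
    (∃! p : Submodule ℂ (PhaseSpace N) × Submodule ℂ (PhaseSpace N),
      S.IsLossSplitting β p.1 p.2) ∧
    ∀ Hhl Hll : Submodule ℂ (PhaseSpace N), S.IsLossSplitting β Hhl Hll →
      -- their dimensions, `N_R` and `2 N - N_R`
      Module.finrank ℂ Hhl = S.R.rank ∧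
      Module.finrank ℂ Hll + S.R.rank = 2 * N ∧
      -- dissipative properties of the two subspaces
      HasRestrictedSpectrum (S.A β) Hll
        {ζ | ζ ∈ spectrum ℂ (S.A β) ∧ 0 ≤ -ζ.im ∧ -ζ.im ≤ S.omegaMax} ∧
      HasRestrictedSpectrum (S.A β) Hhl
        {ζ | ζ ∈ spectrum ℂ (S.A β) ∧ β * S.bMin - S.omegaMax ≤ -ζ.im} ∧
      S.omegaMax < β * S.bMin - S.omegaMax ∧
      (∀ ζ ∈ S.spectrumOne β,
        (1 / 2) * (|ζ.re| / (-ζ.im)) ≤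
          (1 / 2) * (S.omegaMax / (β * S.bMin - S.omegaMax))) ∧
      (1 / 2) * (S.omegaMax / (β * S.bMin - S.omegaMax)) < 1 / 2 ∧
      -- eigenvalue bounds in the low-loss subspace
      (∀ ζ ∈ S.spectrumZero β,
        (∃ ρ ∈ spectrum ℂ S.compressedOmega, ‖ζ - ρ‖ ≤ S.c β) ∧
        (∃ ρ : ℝ, (ρ : ℂ) ∈ spectrum ℂ S.compressedOmega ∧ |ζ.re - ρ| ≤ S.c β) ∧
        0 ≤ -ζ.im ∧ -ζ.im ≤ S.c β) ∧
      -- existence and uniqueness of the splitting of the low-loss subspace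
      (∃! q : Submodule ℂ (PhaseSpace N) × Submodule ℂ (PhaseSpace N),
        S.IsLowLossSplitting β Hll q.1 q.2) ∧
      ∀ H0 H1 : Submodule ℂ (PhaseSpace N), S.IsLowLossSplitting β Hll H0 H1 →
        HasRestrictedSpectrum (S.A β) H1
          (spectrum ℂ (S.A β) ∩ {ζ | S.rhoMin / 2 < ‖ζ‖ ∧ ‖ζ‖ ≤ S.omegaMax}) ∧
        HasRestrictedSpectrum (S.A β) H0
          (spectrum ℂ (S.A β) ∩ {ζ | ‖ζ‖ < S.rhoMin / 2}) ∧
        Module.finrank ℂ H1 = Module.finrank ℂ (LinearMap.range S.compressedOmega) ∧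
        Module.finrank ℂ H0 + Module.finrank ℂ H1 + S.R.rank = 2 * N ∧
        (LinearMap.ker (Matrix.toLin' (S.R.map Complex.ofReal)) ⊓
            LinearMap.ker (Matrix.toLin' (S.η.map Complex.ofReal)) = ⊥ →
          Module.finrank ℂ H1 = 2 * (N - S.R.rank)) := by
  have h := S.isOverdamped hΩ hβ
  have hbeta := S.two_mul_omegaMax_div_bMin_lt hΩ hβ
  have hc := S.c_lt hΩ hβ
  have hρω := S.rhoMin_le_omegaMax hΩ
  have hρ := (S.rhoMin_mem hΩ).1
  have hω := h.ω_pos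
  have hd := h.lt
  have hunion := LagrangianSystem.spectrum_eq_union (S := S) (β := β)
  have hloss := LagrangianSystem.existsUnique_isLossSplitting h
  have hlow := LagrangianSystem.existsUnique_isLowLossSplitting hΩ hβ
  have hzero := LagrangianSystem.spectrumZero_eq_union hΩ hβ
  have hnear : ∀ ζ ∈ S.spectrumZero β, (∃ ρ ∈ spectrum ℂ S.compressedOmega, ‖ζ - ρ‖ ≤ S.c β) ∧
      (∃ ρ : ℝ, (ρ : ℂ) ∈ spectrum ℂ S.compressedOmega ∧ |ζ.re - ρ| ≤ S.c β) ∧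
      0 ≤ -ζ.im ∧ -ζ.im ≤ S.c β := by
    intro ζ hζ
    obtain ⟨ρ, hρ, hρζ⟩ := LagrangianSystem.exists_near_of_mem_spectrumZero h hζ
    have hre := (Complex.abs_re_le_norm _).trans hρζ
    have him := (Complex.abs_im_le_norm _).trans hρζ
    rw [Complex.sub_re, Complex.ofReal_re] at hre
    rw [Complex.sub_im, Complex.ofReal_im, sub_zero] at him
    exact ⟨⟨ρ, hρ, hρζ⟩, ⟨ρ, hρ, hre⟩, LagrangianSystem.neg_im_nonneg h.β_pos hζ.1,
      (neg_le_abs _).trans him⟩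
  refine ⟨hbeta, hc, by linarith, hunion, LagrangianSystem.disjoint_spectrumZero_spectrumOne h,
    ⟨(_, _), hloss.1, fun p hp ↦ Prod.ext (hloss.2 _ _ hp).1 (hloss.2 _ _ hp).2⟩, ?_⟩
  intro Hhl Hll H
  obtain ⟨rfl, rfl⟩ := hloss.2 _ _ H
  have hll := LagrangianSystem.finrank_low h
  have hker := S.finrank_ker_b
  have hcompl := Submodule.finrank_add_eq_of_isCompl H.isCompl
  have hdim : Module.finrank ℂ (PhaseSpace N) = 2 * N := by
    rw [finrank_euclideanSpace, Fintype.card_sum, Fintype.card_fin, two_mul]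
  refine ⟨by omega, by omega, H.spectrum_low.congr ?_, H.spectrum_high.congr ?_, by linarith, ?_,
    ?_, hnear, ⟨(_, _), hlow.1, fun q hq ↦ Prod.ext (hlow.2 _ _ hq).1 (hlow.2 _ _ hq).2⟩, ?_⟩
  · ext ζ
    constructor
    · intro hζ
      exact ⟨hζ.1, LagrangianSystem.neg_im_nonneg h.β_pos hζ.1,
        LagrangianSystem.neg_im_le_of_mem_spectrumZero hζ⟩
    · rintro ⟨hζ, -, him⟩
      rw [hunion] at hζ
      refine hζ.resolve_right fun h1 ↦ ?_
      linarith [(LagrangianSystem.neg_im_ge_of_mem_spectrumOne h h1).1]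
  · ext ζ
    constructor
    · intro hζ
      exact ⟨hζ.1, (LagrangianSystem.neg_im_ge_of_mem_spectrumOne h hζ).1⟩
    · rintro ⟨hζ, him⟩
      rw [hunion] at hζ
      refine hζ.resolve_left fun h1 ↦ ?_
      linarith [LagrangianSystem.neg_im_le_of_mem_spectrumZero h1]
  · intro ζ hζ
    obtain ⟨him, hre⟩ := LagrangianSystem.neg_im_ge_of_mem_spectrumOne h hζ
    have hpos : 0 < β * S.bMin - S.omegaMax := by linarith
    exact mul_le_mul_of_nonneg_left (div_le_div₀ hω.le hre hpos him) one_half_pos.le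
  · have hlt : S.omegaMax / (β * S.bMin - S.omegaMax) < 1 := by
      rw [div_lt_one] <;> linarith
    linarith
  · intro H0 H1 H'
    obtain ⟨rfl, rfl⟩ := hlow.2 _ _ H'
    have hone := LagrangianSystem.finrank_lowLoss_one hΩ hβ
    have hsum := finrank_spectralSubspace_union (S.A β) (LagrangianSystem.disjoint_lowLoss hΩ hβ)
    rw [← hzero, hll] at hsum
    have hbig : ∀ ζ ∈ S.rhoDiscs (S.c β), S.rhoMin / 2 < ‖ζ‖ := fun ζ hζ ↦ by
      linarith [(LagrangianSystem.abs_re_of_mem_rhoDiscs hζ).1, Complex.abs_re_le_norm ζ]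
    have hsmall : ∀ ζ ∈ Metric.closedBall (0 : ℂ) (S.c β), ‖ζ‖ < S.rhoMin / 2 := fun ζ hζ ↦
      (mem_closedBall_zero_iff.1 hζ).trans_lt hc
    refine ⟨H'.spectrum_one.congr ?_, H'.spectrum_zero.congr ?_, hone, by omega, fun hR ↦ ?_⟩
    · ext ζ
      constructor
      · intro hζ
        have h1 : ζ ∈ S.spectrumZero β := hzero ▸ Or.inr hζ
        exact ⟨hζ.1, hbig ζ hζ.2, mem_closedBall_zero_iff.1 h1.2⟩
      · rintro ⟨hζ, h1, h2⟩
        have h3 : ζ ∈ S.spectrumZero β := ⟨hζ, mem_closedBall_zero_iff.2 h2⟩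
        rw [hzero] at h3
        exact h3.resolve_left fun h4 ↦ lt_asymm h1 (hsmall ζ h4.2)
    · ext ζ
      constructor
      · intro hζ
        exact ⟨hζ.1, hsmall ζ hζ.2⟩
      · rintro ⟨hζ, h1⟩
        rw [Set.mem_ofPred_eq] at h1
        have h3 : ζ ∈ S.spectrumZero β := ⟨hζ, mem_closedBall_zero_iff.2 (by linarith)⟩
        rw [hzero] at h3
        exact h3.resolve_right fun h4 ↦ lt_asymm h1 (hbig ζ h4.2)
    · rw [hone, S.finrank_range_compressedOmega hR]
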